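/- A triangle is the outline (the union of the three sides) of a non-degenerate triangle in $\mathbb R^3$, considered as a subset of $\mathbb R^3$; $\langle X\rangle$ denotes the convex hull of $X$. A linking of three triangles is a non-ordered set of three pairwise disjoint triangles. Let $ABC$ be a triangle of a linking $\Delta$, and let $C'$ be a point outside the line $AB$ such that $(\langle ACC'\rangle\cup\langle BCC'\rangle)\cap XYZ=\emptyset$ for every other triangle $XYZ$ of $\Delta$. The replacement of $ABC$ by $ABC'$ in $\Delta$ is called an elementary move. Two linkings are combinatorially isotopic if one can be obtained from the other by a finite sequence of elementary moves. For disjoint triangles $S,T$, say that $\langle S\rangle$ and $T$ cross at exactly one point if $\langle S\rangle\cap T$ consists of exactly one point and $T$ has points strictly on both sides of the plane of $S$ (that is, $T$ does not merely touch $\langle S\rangle$ at a vertex of $T$). Consider the following five classes of linkings of three triangles. 1. Linkings of three triangles whose convex hulls are pairwise disjoint. 2. The Borromean (Valknut) linking, formed by the triangle $\Delta_1$ with vertices $(1,0,0)$, $\left(-\frac2{\sqrt5},\pm\frac1{\sqrt{10}},0\right)$ and the triangles $\Delta_2,\Delta_3$, where $\Delta_j$ is obtained from $\Delta_{j-1}$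 by the cyclic permutation $x\to y\to z\to x$ of coordinates. 3. Linkings of triangles $\Delta_1,\Delta_2,\Delta_3$ such that $\langle\Delta_1\rangle$ and $\Delta_2$ cross at exactly one point, and $\langle\Delta_3\rangle$ is disjoint from $\Delta_1$ and from $\Delta_2$. 4. Linkings of triangles $\Delta_1,\Delta_2,\Delta_3$ such that $\langle\Delta_2\rangle\cap\langle\Delta_3\rangle=\emptyset$, and each of $\langle\Delta_2\rangle$, $\langle\Delta_3\rangle$ crosses $\Delta_1$ at exactly one point. 5. Linkings formed by an equilateral triangle $\Delta_1$ with a chosen altitude and the triangles $\Delta_2=g(\Delta_1)$, $\Delta_3=g(\Delta_2)$, where $g$ is the composition of a rotation by $\pi/3$ (in either sense) around the line of the altitude and the translation by $\vec h$, where $3\vec h$ is the altitude considered as a vector (in either direction). Then no linking from one of these classes is combinatorially isotopic to a linking from another of these classes. -/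

import Mathlib

namespace TriangleLinking

/-- Euclidean 3-space. -/
abbrev E3 : Type := EuclideanSpace ℝ (Fin 3)

/-- The outline of the triangle with vertices `A`, `B`, `C`, as a subset of 3-space. -/
def outline (A B C : E3) : Set E3 :=
  segment ℝ A B ∪ segment ℝ B C ∪ segment ℝ C A

/-- A triangle is the outline of a non-degenerate triangle; its vertices are not numbered. -/
def IsTriangle (T : Set E3) : Prop :=
  ∃ A B C : E3, AffineIndependent ℝ ![A, B, C] ∧ T = outline A B C

/-- A linking of three non-ordered triangles: a set of three pairwise disjoint triangles. -/
def IsTripleLinking (L : Set (Set E3)) : Prop :=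
  L.ncard = 3 ∧ (∀ T ∈ L, IsTriangle T) ∧ L.Pairwise Disjoint

/-- The elementary move: the triangle `ABC` of `L` is replaced by `ABC'`, where `C'` is outside
the line `AB` and the convex hulls of `ACC'` and of `BCC'` miss every other triangle of `L`. -/
def ElementaryMove (L L' : Set (Set E3)) : Prop :=
  ∃ A B C C' : E3,
    AffineIndependent ℝ ![A, B, C] ∧ outline A B C ∈ L ∧
    C' ∉ line[ℝ, A, B] ∧
    (∀ T ∈ L, T ≠ outline A B C →
      (convexHull ℝ {A, C, C'} ∪ convexHull ℝ {B, C, C'}) ∩ T = ∅) ∧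
    L' = insert (outline A B C') (L \ {outline A B C})

/-- Combinatorial isotopy: `L'` is obtained from `L` by a finite (possibly empty) sequence of
elementary moves. -/
def CombIsotopic (L L' : Set (Set E3)) : Prop :=
  Relation.ReflTransGen ElementaryMove L L'

/-- The convex hull of the triangle `S` meets the triangle `T` at exactly one point, and `T` does
not merely touch it there: `T` has points strictly on both sides of the plane of `S`. -/
def HopfLinked (S T : Set E3) : Prop :=
  (∃ p : E3, convexHull ℝ S ∩ T = {p}) ∧
    ∃ x ∈ T, ∃ y ∈ T, (affineSpan ℝ S).SOppSide x y

/-- Three triangles whose convex hulls are pairwise disjoint. -/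
def separated : Set (Set (Set E3)) :=
  {L | IsTripleLinking L ∧ ∃ T₁ T₂ T₃ : Set E3, L = {T₁, T₂, T₃} ∧
    Disjoint (convexHull ℝ T₁) (convexHull ℝ T₂) ∧
    Disjoint (convexHull ℝ T₁) (convexHull ℝ T₃) ∧
    Disjoint (convexHull ℝ T₂) (convexHull ℝ T₃)}

/-- The cyclic permutation of the coordinates, sending the `x`-axis to the `y`-axis, the `y`-axis
to the `z`-axis and the `z`-axis to the `x`-axis. -/
def cyc (p : E3) : E3 := !₂[p 2, p 0, p 1]

/-- The first triangle of the Borromean (Valknut) linking. -/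
noncomputable def borromeanTriangle : Set E3 :=
  outline !₂[1, 0, 0] !₂[-(2 / √5), 1 / √10, 0] !₂[-(2 / √5), -(1 / √10), 0]

/-- The Borromean (Valknut) linking. -/
noncomputable def borromean : Set (Set (Set E3)) :=
  {{borromeanTriangle, cyc '' borromeanTriangle, cyc '' (cyc '' borromeanTriangle)}}

/-- The Hopf linking of two triangles, together with a triangle whose convex hull is disjoint from
these two triangles. -/
def hopfPlusOne : Set (Set (Set E3)) :=
  {L | IsTripleLinking L ∧ ∃ T₁ T₂ T₃ : Set E3, L = {T₁, T₂, T₃} ∧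
    HopfLinked T₁ T₂ ∧ Disjoint (convexHull ℝ T₃) T₁ ∧ Disjoint (convexHull ℝ T₃) T₂}

/-- A triangle together with two triangles whose convex hulls are disjoint and both intersect the
first triangle at exactly one point. -/
def openChain : Set (Set (Set E3)) :=
  {L | IsTripleLinking L ∧ ∃ T₁ T₂ T₃ : Set E3, L = {T₁, T₂, T₃} ∧
    Disjoint (convexHull ℝ T₂) (convexHull ℝ T₃) ∧ HopfLinked T₂ T₁ ∧ HopfLinked T₃ T₁}

/-- The rotation of 3-space about the line through the origin directed by the unit vector `u`, by
the angle `θ` (Rodrigues' formula). -/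
noncomputable def rotateAxis (u : E3) (θ : ℝ) (x : E3) : E3 :=
  Real.cos θ • x + Real.sin θ • WithLp.toLp 2 (crossProduct u.ofLp x.ofLp) +
    ((1 - Real.cos θ) * inner ℝ u x) • u

/-- The rotation about the line through `p` directed by the unit vector `u`, by the angle `θ`,
followed by the translation by `h`. -/
noncomputable def screw (p u : E3) (θ : ℝ) (h : E3) (x : E3) : E3 :=
  (rotateAxis u θ (x - p) + p) + h

/-- The cyclic chain: an equilateral triangle `ABC` with altitude `AF`, its image under the
rotation about this altitude by `π / 3` composed with the translation by one third of the altitude,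
and the image of that image under the same motion (which keeps the line `AF` and the vector
`F - A`, hence is also the motion built from the corresponding altitude of the second triangle).
Either direction of the altitude and either sense of rotation is allowed. -/
noncomputable def cyclicChain : Set (Set (Set E3)) :=
  {L | ∃ A B C F h : E3, ∃ θ : ℝ,
    A ≠ B ∧ dist A B = dist B C ∧ dist B C = dist C A ∧
    F ∈ line[ℝ, B, C] ∧ inner ℝ (F - A) (C - B) = 0 ∧
    (h = (1 / 3 : ℝ) • (F - A) ∨ h = (1 / 3 : ℝ) • (A - F)) ∧
    (θ = Real.pi / 3 ∨ θ = -(Real.pi / 3)) ∧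
    let g : E3 → E3 := screw A (‖F - A‖⁻¹ • (F - A)) θ h
    L = {outline A B C, g '' outline A B C, g '' (g '' outline A B C)}}

/-- The five listed classes of linkings of three triangles. -/
noncomputable def listed : Fin 5 → Set (Set (Set E3)) :=
  ![separated, borromean, hopfPlusOne, openChain, cyclicChain]

end TriangleLinking

open Filter Topology

namespace TriangleLinking

/-! An elementary move slides one vertex along a segment while the moving outline stays disjoint
from the other two triangles. It is therefore a continuous path of loops, possibly degenerate on the
way, and every property that is both open and closed in the path parameter is preserved. Two such
properties separate the classes.

The first is `Linked`, in the role of the linking number modulo 2. Closedness is compactness. For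
openness (`Linked.eventually_meets`), disjoint linked outlines are not coplanar, so where one of
them meets the hull of the other it passes strictly from one side of that plane to the other, and
such a crossing survives small motions. The five classes have 0, 0, 1, 2, 3 linked pairs;
`SomeLinked`, `HasCenter` and `AllLinked` record whether there is at least one, two or three.

The second, `BorromeanTriple`, separates the two classes without linked pairs. If the normals of its
three planes were dependent, a ray from the common point parallel to all three planes would leave
each triangle strictly later than the next one in cyclic order, which is absurd. So the planes meet
transversally in a point interior to all three triangles, and that point persists: this is openness.
For closedness (`isClopen_borromeanTriple`), linking is constant along the path, so for the unlinked
pairs in question the open condition that `S` misses the hull of `T` can be traded for the closed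
one that `T` meets the hull of `S`.

For the values on the classes, `HopfLinked.linked` turns a single transverse crossing into linking,
and the triangles of the cyclic chain share the line of an altitude, on which their apexes and base
midpoints interleave. -/

theorem mem_hull {A B C x : E3} : x ∈ convexHull ℝ (outline A B C) ↔
    ∃ a b c : ℝ, 0 ≤ a ∧ 0 ≤ b ∧ 0 ≤ c ∧ a + b + c = 1 ∧ x = a • A + b • B + c • C := by
  have h : convexHull ℝ (outline A B C) = convexHull ℝ {A, B, C} := by
    apply subset_antisymm
    · apply convexHull_min _ (convex_convexHull _ _)
      have hA : A ∈ convexHull ℝ ({A, B, C} : Set E3) := subset_convexHull _ _ (by simp)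
      have hB : B ∈ convexHull ℝ ({A, B, C} : Set E3) := subset_convexHull _ _ (by simp)
      have hC : C ∈ convexHull ℝ ({A, B, C} : Set E3) := subset_convexHull _ _ (by simp)
      have hc := convex_convexHull ℝ ({A, B, C} : Set E3)
      exact Set.union_subset (Set.union_subset (hc.segment_subset hA hB)
        (hc.segment_subset hB hC)) (hc.segment_subset hC hA)
    · apply convexHull_mono
      rintro y (rfl | rfl | rfl)
      · exact Or.inl (Or.inl (left_mem_segment _ _ _))
      · exact Or.inl (Or.inl (right_mem_segment _ _ _))
      · exact Or.inr (left_mem_segment _ _ _)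
  rw [h, convexHull_insert (by simp)]
  simp only [convexHull_pair, mem_convexJoin, Set.mem_singleton_iff, exists_eq_left]
  constructor
  · rintro ⟨y, ⟨p, q, hp, hq, hpq, rfl⟩, ⟨r, s, hr, hs, hrs, rfl⟩⟩
    refine ⟨r, s * p, s * q, hr, by positivity, by positivity, ?_, ?_⟩
    · rw [add_assoc, ← mul_add, hpq, mul_one, hrs]
    · simp only [smul_add, smul_smul, add_assoc]
  · rintro ⟨a, b, c, ha, hb, hc, habc, rfl⟩
    rcases (add_nonneg hb hc).eq_or_lt with h0 | h0
    · have hb0 : b = 0 := by linarith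
      have hc0 : c = 0 := by linarith
      subst hb0 hc0
      refine ⟨B, left_mem_segment _ _ _, ?_⟩
      have : a = 1 := by linarith
      subst this
      simpa using left_mem_segment ℝ A B
    · refine ⟨(b / (b + c)) • B + (c / (b + c)) • C, ⟨b / (b + c), c / (b + c), by positivity,
        by positivity, by field_simp, rfl⟩, a, b + c, ha, h0.le, by linarith, ?_⟩
      rw [smul_add, smul_smul, smul_smul, mul_div_cancel₀ _ h0.ne', mul_div_cancel₀ _ h0.ne',
        add_assoc]

theorem mem_outline {A B C x : E3} : x ∈ outline A B C ↔
    ∃ a b c : ℝ, 0 ≤ a ∧ 0 ≤ b ∧ 0 ≤ c ∧ a + b + c = 1 ∧ (a = 0 ∨ b = 0 ∨ c = 0) ∧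
      x = a • A + b • B + c • C := by
  constructor
  · rintro ((⟨p, q, hp, hq, hpq, rfl⟩ | ⟨p, q, hp, hq, hpq, rfl⟩) | ⟨p, q, hp, hq, hpq, rfl⟩)
    · exact ⟨p, q, 0, hp, hq, le_rfl, by linarith, by simp, by simp⟩
    · exact ⟨0, p, q, le_rfl, hp, hq, by linarith, by simp, by simp⟩
    · exact ⟨q, 0, p, hq, le_rfl, hp, by linarith, by simp, by simp [add_comm]⟩
  · rintro ⟨a, b, c, ha, hb, hc, habc, rfl | rfl | rfl, rfl⟩
    · exact Or.inl (Or.inr ⟨b, c, hb, hc, by linarith, by simp⟩)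
    · exact Or.inr ⟨c, a, hc, ha, by linarith, by simp [add_comm]⟩
    · exact Or.inl (Or.inl ⟨a, b, ha, hb, by linarith, by simp⟩)

theorem outline_subset_hull {S : Set E3} : S ⊆ convexHull ℝ S := subset_convexHull ℝ S

theorem outline_rotate (A B C : E3) : outline B C A = outline A B C := by
  ext x; simp only [outline, Set.mem_union]; tauto

/-! ### Heights and barycentric coordinates -/

/-- A normal vector of the plane through `A`, `B`, `C`; it vanishes for collinear points. -/
noncomputable def normal (A B C : E3) : E3 :=
  !₂[(B 1 - A 1) * (C 2 - A 2) - (B 2 - A 2) * (C 1 - A 1),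
    (B 2 - A 2) * (C 0 - A 0) - (B 0 - A 0) * (C 2 - A 2),
    (B 0 - A 0) * (C 1 - A 1) - (B 1 - A 1) * (C 0 - A 0)]

/-- The dot product in coordinates. -/
def dot (x y : E3) : ℝ := x 0 * y 0 + x 1 * y 1 + x 2 * y 2

/-- The height of `x` over the plane through `A`, `B`, `C`, scaled by the normal vector. -/
noncomputable def height (A B C x : E3) : ℝ := dot (normal A B C) (x - A)

theorem dot_self_pos {n : E3} (hn : n ≠ 0) : 0 < dot n n := by
  rcases lt_or_eq_of_le (show 0 ≤ dot n n by unfold dot; nlinarith [sq_nonneg (n 0)]) with h | h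
  · exact h
  · refine absurd ?_ hn
    unfold dot at h
    ext i
    fin_cases i <;> simp <;> nlinarith [sq_nonneg (n 0), sq_nonneg (n 1), sq_nonneg (n 2)]

/-- The barycentric coordinate of `x` at `B`, for `x` in the plane of `A`, `B`, `C`. -/
noncomputable def baryB (A B C x : E3) : ℝ :=
  dot (normal A x C) (normal A B C) / dot (normal A B C) (normal A B C)

/-- The barycentric coordinate of `x` at `C`, for `x` in the plane of `A`, `B`, `C`. -/
noncomputable def baryC (A B C x : E3) : ℝ :=
  dot (normal A B x) (normal A B C) / dot (normal A B C) (normal A B C)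

/-- Decomposition of `x - A` along the basis `n`, `B - A`, `C - A` with `n` the normal. Being
rational in the points, these coordinates vary continuously with them. -/
theorem eq_bary {A B C x : E3} (hn : normal A B C ≠ 0) (hx : height A B C x = 0) :
    x = (1 - baryB A B C x - baryC A B C x) • A + baryB A B C x • B + baryC A B C x • C := by
  have h := (dot_self_pos hn).ne'
  have key : ∀ i, dot (normal A B C) (normal A B C) * (x i - A i) =
      height A B C x * normal A B C i + dot (normal A x C) (normal A B C) * (B i - A i) +
      dot (normal A B x) (normal A B C) * (C i - A i) := by
    intro i
    fin_cases i <;> simp [dot, normal, height] <;> ring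
  ext i
  have k := key i
  rw [hx] at k
  simp only [baryB, baryC, PiLp.add_apply, PiLp.smul_apply, smul_eq_mul]
  field_simp
  linarith

theorem bary_eq {A B C : E3} {a b c : ℝ} (hn : normal A B C ≠ 0) (h : a + b + c = 1) :
    baryB A B C (a • A + b • B + c • C) = b ∧ baryC A B C (a • A + b • B + c • C) = c := by
  have h0 := (dot_self_pos hn).ne'
  obtain rfl : a = 1 - b - c := by linarith
  constructor
  · rw [baryB, div_eq_iff h0]
    simp [dot, normal]
    ring
  · rw [baryC, div_eq_iff h0]
    simp [dot, normal]
    ring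

theorem height_comb {X Y Z A B C : E3} {a b c : ℝ} (h : a + b + c = 1) :
    height X Y Z (a • A + b • B + c • C) =
      a * height X Y Z A + b * height X Y Z B + c * height X Y Z C := by
  obtain rfl : a = 1 - b - c := by linarith
  simp [height, dot]
  ring

theorem height_vertices (A B C : E3) :
    height A B C A = 0 ∧ height A B C B = 0 ∧ height A B C C = 0 := by
  refine ⟨?_, ?_, ?_⟩ <;> simp [height, dot, normal] <;> ring

theorem height_hull {A B C x : E3} (hx : x ∈ convexHull ℝ (outline A B C)) :
    height A B C x = 0 := by
  obtain ⟨a, b, c, -, -, -, h, rfl⟩ := mem_hull.1 hx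
  obtain ⟨h1, h2, h3⟩ := height_vertices A B C
  rw [height_comb h, h1, h2, h3]; ring

/-! ### Rays leaving a triangle through its outline -/

/-- A line in weight space through a point of the simplex meets the boundary of the simplex. -/
theorem exists_exit_weights {a b c d e f : ℝ} (ha : 0 ≤ a) (hb : 0 ≤ b) (hc : 0 ≤ c)
    (h : a + b + c = 1) (hs : d + e + f = 0) (hne : d ≠ 0 ∨ e ≠ 0 ∨ f ≠ 0) :
    ∃ m : ℝ, 0 ≤ m ∧ 0 ≤ a + m * d ∧ 0 ≤ b + m * e ∧ 0 ≤ c + m * f ∧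
      (a + m * d = 0 ∨ b + m * e = 0 ∨ c + m * f = 0) := by
  have hneg : d < 0 ∨ e < 0 ∨ f < 0 := by
    by_contra! hcon
    obtain ⟨h1, h2, h3⟩ := hcon
    rcases hne with h' | h' | h' <;> exact h' (by linarith)
  -- The smallest weight starts nonnegative and is eventually at most zero, because some weight
  -- decreases; the exit time is a zero given by the intermediate value theorem.
  let φ : ℝ → ℝ := fun m => min (a + m * d) (min (b + m * e) (c + m * f))
  have hφ : Continuous φ := by fun_prop
  have hφ0 : 0 ≤ φ 0 := by simp [φ, ha, hb, hc]
  obtain ⟨M, hM, hM0⟩ : ∃ M, 0 ≤ M ∧ φ M ≤ 0 := by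
    have aux : ∀ p q : ℝ, p ≤ 1 → q < 0 → p + (-q)⁻¹ * q ≤ 0 := by
      intro p q hp hq
      have : (-q)⁻¹ * q = -1 := by field_simp [hq.ne]
      linarith
    rcases hneg with h' | h' | h'
    · exact ⟨(-d)⁻¹, inv_nonneg.2 (by linarith),
        (min_le_left _ _).trans (aux _ _ (by linarith) h')⟩
    · exact ⟨(-e)⁻¹, inv_nonneg.2 (by linarith),
        ((min_le_right _ _).trans (min_le_left _ _)).trans (aux _ _ (by linarith) h')⟩
    · exact ⟨(-f)⁻¹, inv_nonneg.2 (by linarith),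
        ((min_le_right _ _).trans (min_le_right _ _)).trans (aux _ _ (by linarith) h')⟩
  obtain ⟨m, hm, hm0⟩ := intermediate_value_Icc' hM hφ.continuousOn ⟨hM0, hφ0⟩
  have h1 : φ m ≤ a + m * d := min_le_left _ _
  have h2 : φ m ≤ b + m * e := (min_le_right _ _).trans (min_le_left _ _)
  have h3 : φ m ≤ c + m * f := (min_le_right _ _).trans (min_le_right _ _)
  rw [hm0] at h1 h2 h3
  refine ⟨m, hm.1, h1, h2, h3, ?_⟩
  simp only [φ] at hm0
  rcases min_choice (a + m * d) (min (b + m * e) (c + m * f)) with hh | hh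
  · exact Or.inl (hh ▸ hm0)
  · rw [hh] at hm0
    rcases min_choice (b + m * e) (c + m * f) with hh | hh
    · exact Or.inr (Or.inl (hh ▸ hm0))
    · exact Or.inr (Or.inr (hh ▸ hm0))

/-- The motion takes place in weight space, so `v = 0` is allowed as long as its weights are not all
zero; this is what handles degenerate triangles. -/
theorem exists_exit_of_comb {A B C o v : E3} {d e f : ℝ}
    (ho : o ∈ convexHull ℝ (outline A B C)) (hs : d + e + f = 0)
    (hne : d ≠ 0 ∨ e ≠ 0 ∨ f ≠ 0) (hv : v = d • A + e • B + f • C) :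
    ∃ m : ℝ, 0 ≤ m ∧ o + m • v ∈ outline A B C := by
  obtain ⟨a, b, c, ha, hb, hc, h, rfl⟩ := mem_hull.1 ho
  obtain ⟨m, hm, h1, h2, h3, h4⟩ := exists_exit_weights ha hb hc h hs hne
  refine ⟨m, hm, mem_outline.2 ⟨_, _, _, h1, h2, h3, ?_, h4, ?_⟩⟩
  · linear_combination h + m * hs
  · rw [hv]; module

/-- The vertices of a degenerate triangle satisfy a nontrivial affine relation. -/
theorem exists_relation_of_normal_eq_zero {A B C : E3} (hn : normal A B C = 0) :
    ∃ p q : ℝ, (p ≠ 0 ∨ q ≠ 0) ∧ p • (B - A) + q • (C - A) = 0 := by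
  have hN : ∀ i, normal A B C i = 0 := fun i => by rw [hn]; rfl
  have h0 := hN 0
  have h1 := hN 1
  have h2 := hN 2
  simp [normal] at h0 h1 h2
  by_cases hz : ∃ i, B i - A i ≠ 0
  · obtain ⟨i, hi⟩ := hz
    refine ⟨-(C i - A i), B i - A i, Or.inr hi, ?_⟩
    ext j
    fin_cases i <;> fin_cases j <;> simp <;> linarith
  · push Not at hz
    refine ⟨1, 0, Or.inl one_ne_zero, ?_⟩
    ext j
    simpa using hz j

theorem normal_ne_zero_of_affineIndependent {A B C : E3} (h : AffineIndependent ℝ ![A, B, C]) :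
    normal A B C ≠ 0 := by
  intro hn
  obtain ⟨p, q, hpq, h0⟩ := exists_relation_of_normal_eq_zero hn
  have h1 := affineIndependent_iff.1 h Finset.univ ![-p - q, p, q]
    (by simp [Fin.sum_univ_three]; ring)
    (by rw [← h0]; simp [Fin.sum_univ_three]; module)
  have e1 := h1 1 (Finset.mem_univ _)
  have e2 := h1 2 (Finset.mem_univ _)
  simp at e1 e2
  tauto

/-- The hull of a degenerate triangle is its outline. -/
theorem mem_outline_of_normal_eq_zero {A B C x : E3} (hn : normal A B C = 0)
    (hx : x ∈ convexHull ℝ (outline A B C)) : x ∈ outline A B C := by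
  obtain ⟨p, q, hpq, h0⟩ := exists_relation_of_normal_eq_zero hn
  -- A relation between the vertices represents the zero vector: the weights move to the boundary of
  -- the simplex while the point stays fixed.
  obtain ⟨m, -, h⟩ := exists_exit_of_comb (v := 0) (d := -p - q) (e := p) (f := q) hx (by ring)
    (by tauto) (by rw [← h0]; module)
  simpa using h

/-- A ray from a point of a triangle, parallel to its plane, meets the outline. -/
theorem exists_exit {A B C o v : E3} (ho : o ∈ convexHull ℝ (outline A B C)) (hv : v ≠ 0)
    (hnv : dot (normal A B C) v = 0) : ∃ m : ℝ, 0 ≤ m ∧ o + m • v ∈ outline A B C := by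
  by_cases hn : normal A B C = 0
  · exact ⟨0, le_rfl, by simpa using mem_outline_of_normal_eq_zero hn ho⟩
  · have h := eq_bary (x := A + v) hn (by simpa [height] using hnv)
    set b := baryB A B C (A + v)
    set c := baryC A B C (A + v)
    have hv' : v = (-b - c) • A + b • B + c • C := by
      rw [← add_right_inj A, h]; module
    refine exists_exit_of_comb ho (by ring) ?_ hv'
    by_contra! hcon
    apply hv
    rw [hv', hcon.1, hcon.2.1, hcon.2.2]
    simp

theorem exit_mem_hull {A B C o v : E3} {m τ : ℝ} (ho : o ∈ convexHull ℝ (outline A B C))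
    (hm : o + m • v ∈ outline A B C) (h0 : 0 ≤ τ) (h1 : τ ≤ m) :
    o + τ • v ∈ convexHull ℝ (outline A B C) := by
  rcases h0.eq_or_lt with rfl | h0
  · simpa using ho
  have hmp : 0 < m := by linarith
  have hc := convex_convexHull ℝ (outline A B C)
  have := hc ho (subset_convexHull _ _ hm) (a := 1 - τ / m) (b := τ / m)
    (by rw [sub_nonneg, div_le_one hmp]; exact h1) (by positivity) (by ring)
  convert this using 1
  rw [smul_add, smul_smul, div_mul_cancel₀ _ hmp.ne']
  module

/-- A segment in the plane of a triangle that starts in the triangle and misses the outline stays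
in the triangle. -/
theorem mem_hull_of_segment_disjoint {A B C p q : E3} (hp : p ∈ convexHull ℝ (outline A B C))
    (hq : height A B C q = 0) (hd : ∀ x ∈ segment ℝ p q, x ∉ outline A B C) :
    q ∈ convexHull ℝ (outline A B C) := by
  by_cases hpq : q - p = 0
  · rw [sub_eq_zero] at hpq; rwa [hpq]
  obtain ⟨m, hm, h⟩ := exists_exit hp hpq (by
    have h2 := height_hull hp
    unfold height at hq h2
    have : dot (normal A B C) (q - p) = dot (normal A B C) (q - A) - dot (normal A B C) (p - A) := by
      simp [dot]; ring
    rw [this, hq, h2, sub_zero])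
  -- An exit time at most 1 would give a point of the outline on the segment.
  rcases le_or_gt m 1 with h1 | h1
  · refine absurd h (hd _ ?_)
    rw [segment_eq_image']
    exact ⟨m, ⟨hm, h1⟩, rfl⟩
  · have := exit_mem_hull hp h zero_le_one h1.le
    simpa using this

theorem exists_pos_weights {A B C x : E3} (hx : x ∈ convexHull ℝ (outline A B C))
    (hx' : x ∉ outline A B C) :
    ∃ a b c : ℝ, 0 < a ∧ 0 < b ∧ 0 < c ∧ a + b + c = 1 ∧ x = a • A + b • B + c • C := by
  obtain ⟨a, b, c, ha, hb, hc, h, he⟩ := mem_hull.1 hx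
  have hne : ¬ (a = 0 ∨ b = 0 ∨ c = 0) := fun h' =>
    hx' (mem_outline.2 ⟨a, b, c, ha, hb, hc, h, h', he⟩)
  push Not at hne
  exact ⟨a, b, c, ha.lt_of_ne' hne.1, hb.lt_of_ne' hne.2.1, hc.lt_of_ne' hne.2.2, h, he⟩

theorem normal_ne_zero_of_mem_hull {A B C x : E3} (hx : x ∈ convexHull ℝ (outline A B C))
    (hx' : x ∉ outline A B C) : normal A B C ≠ 0 :=
  fun h => hx' (mem_outline_of_normal_eq_zero h hx)

/-! ### Positivity of barycentric coordinates as an open condition -/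

/-- The condition that the barycentric coordinates of `x` are positive. -/
def BaryPos (A B C x : E3) : Prop :=
  0 < 1 - baryB A B C x - baryC A B C x ∧ 0 < baryB A B C x ∧ 0 < baryC A B C x

theorem baryPos_of_mem {A B C x : E3} (hx : x ∈ convexHull ℝ (outline A B C))
    (hx' : x ∉ outline A B C) : BaryPos A B C x := by
  have hn := normal_ne_zero_of_mem_hull hx hx'
  obtain ⟨a, b, c, ha, hb, hc, h, rfl⟩ := exists_pos_weights hx hx'
  obtain ⟨h1, h2⟩ := bary_eq (A := A) (B := B) (C := C) hn h
  rw [BaryPos, h1, h2]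
  exact ⟨by linarith, hb, hc⟩

theorem BaryPos.mem_hull {A B C x : E3} (h : BaryPos A B C x) (hn : normal A B C ≠ 0)
    (hx : height A B C x = 0) : x ∈ convexHull ℝ (outline A B C) :=
  TriangleLinking.mem_hull.2 ⟨_, _, _, h.1.le, h.2.1.le, h.2.2.le, by ring, eq_bary hn hx⟩

theorem dot_continuousAt {I : Type*} [TopologicalSpace I] {x y : I → E3} {t : I}
    (hx : ContinuousAt x t) (hy : ContinuousAt y t) :
    ContinuousAt (fun i => dot (x i) (y i)) t := by
  have h : ∀ {z : I → E3}, ContinuousAt z t → ∀ k, ContinuousAt (fun i => z i k) t :=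
    fun hz k => (EuclideanSpace.proj (𝕜 := ℝ) k).continuous.continuousAt.comp hz
  exact (((h hx 0).mul (h hy 0)).add ((h hx 1).mul (h hy 1))).add ((h hx 2).mul (h hy 2))

theorem normal_continuousAt {I : Type*} [TopologicalSpace I] {A B C : I → E3} {t : I}
    (hA : ContinuousAt A t) (hB : ContinuousAt B t) (hC : ContinuousAt C t) :
    ContinuousAt (fun i => normal (A i) (B i) (C i)) t := by
  have h : ∀ {z : I → E3}, ContinuousAt z t → ∀ k, ContinuousAt (fun i => z i k) t :=
    fun hz k => (EuclideanSpace.proj (𝕜 := ℝ) k).continuous.continuousAt.comp hz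
  refine (PiLp.continuous_toLp 2 _).continuousAt.comp (continuousAt_pi.2 fun k => ?_)
  fin_cases k
  · exact (((h hB 1).sub (h hA 1)).mul ((h hC 2).sub (h hA 2))).sub
      (((h hB 2).sub (h hA 2)).mul ((h hC 1).sub (h hA 1)))
  · exact (((h hB 2).sub (h hA 2)).mul ((h hC 0).sub (h hA 0))).sub
      (((h hB 0).sub (h hA 0)).mul ((h hC 2).sub (h hA 2)))
  · exact (((h hB 0).sub (h hA 0)).mul ((h hC 1).sub (h hA 1))).sub
      (((h hB 1).sub (h hA 1)).mul ((h hC 0).sub (h hA 0)))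

theorem height_continuousAt {I : Type*} [TopologicalSpace I] {A B C x : I → E3} {t : I}
    (hA : ContinuousAt A t) (hB : ContinuousAt B t) (hC : ContinuousAt C t)
    (hx : ContinuousAt x t) : ContinuousAt (fun i => height (A i) (B i) (C i) (x i)) t :=
  dot_continuousAt (normal_continuousAt hA hB hC) (hx.sub hA)

theorem BaryPos.eventually {I : Type*} [TopologicalSpace I] {A B C x : I → E3} {t : I}
    (hA : ContinuousAt A t) (hB : ContinuousAt B t) (hC : ContinuousAt C t)
    (hx : ContinuousAt x t) (hn : normal (A t) (B t) (C t) ≠ 0)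
    (h : BaryPos (A t) (B t) (C t) (x t)) :
    ∀ᶠ i in 𝓝 t, normal (A i) (B i) (C i) ≠ 0 ∧ BaryPos (A i) (B i) (C i) (x i) := by
  have hN := normal_continuousAt hA hB hC
  have h0 := (dot_self_pos hn).ne'
  have hb : ContinuousAt (fun i => baryB (A i) (B i) (C i) (x i)) t :=
    (dot_continuousAt (normal_continuousAt hA hx hC) hN).div (dot_continuousAt hN hN) h0
  have hc : ContinuousAt (fun i => baryC (A i) (B i) (C i) (x i)) t :=
    (dot_continuousAt (normal_continuousAt hA hB hx) hN).div (dot_continuousAt hN hN) h0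
  have ha := (continuousAt_const (y := (1 : ℝ))).sub hb |>.sub hc
  filter_upwards [hN.eventually_ne hn, ha.eventually (lt_mem_nhds h.1),
    hb.eventually (lt_mem_nhds h.2.1), hc.eventually (lt_mem_nhds h.2.2)] with i h1 h2 h3 h4
  exact ⟨h1, h2, h3, h4⟩

/-! ### Linking modulo 2 and its stability -/

/-- The triple product. -/
def triple (x y z : E3) : ℝ :=
  x 0 * (y 1 * z 2 - y 2 * z 1) + x 1 * (y 2 * z 0 - y 0 * z 2) + x 2 * (y 0 * z 1 - y 1 * z 0)

theorem exists_common_direction {x y z : E3} (h : triple x y z = 0) :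
    ∃ v : E3, v ≠ 0 ∧ dot x v = 0 ∧ dot y v = 0 ∧ dot z v = 0 := by
  obtain ⟨v, hv, h0⟩ := (Matrix.exists_mulVec_eq_zero_iff
    (M := Matrix.of ![x.ofLp, y.ofLp, z.ofLp])).2 (by
      rw [Matrix.det_fin_three]; simp; unfold triple at h; linarith)
  have h1 := congrFun h0 0
  have h2 := congrFun h0 1
  have h3 := congrFun h0 2
  simp [Matrix.mulVec, dotProduct, Fin.sum_univ_three] at h1 h2 h3
  refine ⟨WithLp.toLp 2 v, fun h => hv ?_, h1, h2, h3⟩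
  simpa using congrArg WithLp.ofLp h

/-- Two triangles are linked if each outline meets the convex hull of the other one. For disjoint
outlines this says that the linking number is odd. -/
def Linked (S T : Set E3) : Prop :=
  (S ∩ convexHull ℝ T).Nonempty ∧ (T ∩ convexHull ℝ S).Nonempty

theorem Linked.symm {S T : Set E3} (h : Linked S T) : Linked T S := ⟨h.2, h.1⟩

theorem linked_comm {S T : Set E3} : Linked S T ↔ Linked T S := ⟨.symm, .symm⟩

/-- The outlines of triangles with parameters. -/
def IsLoop (T : Set E3) : Prop := ∃ A B C : E3, T = outline A B C

theorem IsTriangle.isLoop {T : Set E3} (h : IsTriangle T) : IsLoop T := by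
  obtain ⟨A, B, C, -, h⟩ := h
  exact ⟨A, B, C, h⟩

/-- A ray from the common point, parallel to both planes, leaves both triangles; the outline that it
reaches first is reached inside the other hull. -/
theorem meets_or_meets {S T : Set E3} (hS : IsLoop S) (hT : IsLoop T)
    (h : (convexHull ℝ S ∩ convexHull ℝ T).Nonempty) :
    (S ∩ convexHull ℝ T).Nonempty ∨ (T ∩ convexHull ℝ S).Nonempty := by
  obtain ⟨A, B, C, rfl⟩ := hS
  obtain ⟨X, Y, Z, rfl⟩ := hT
  obtain ⟨o, h1, h2⟩ := h
  -- Only two planes matter, so one normal is repeated and the triple product vanishes.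
  obtain ⟨v, hv, hv1, hv2, -⟩ := exists_common_direction
    (x := normal A B C) (y := normal X Y Z) (z := normal X Y Z) (by unfold triple; ring)
  obtain ⟨m, hm, hm'⟩ := exists_exit h1 hv hv1
  obtain ⟨k, hk, hk'⟩ := exists_exit h2 hv hv2
  rcases le_total m k with hmk | hmk
  · exact Or.inl ⟨_, hm', exit_mem_hull h2 hk' hm hmk⟩
  · exact Or.inr ⟨_, hk', exit_mem_hull h1 hm' hk hmk⟩

/-- If a moving two-legged path crosses the plane of a moving triangle inside the triangle, then it
keeps meeting the triangle for a while. -/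
theorem eventually_meets {I : Type*} [TopologicalSpace I] {X Y Z s P Q : I → E3} {t : I}
    (hX : ContinuousAt X t) (hY : ContinuousAt Y t) (hZ : ContinuousAt Z t)
    (hs : ContinuousAt s t) (hP : ContinuousAt P t) (hQ : ContinuousAt Q t)
    (hst : s t ∈ convexHull ℝ (outline (X t) (Y t) (Z t)))
    (hst' : s t ∉ outline (X t) (Y t) (Z t))
    (hfP : height (X t) (Y t) (Z t) (P t) < 0) (hfQ : 0 < height (X t) (Y t) (Z t) (Q t)) :
    ∀ᶠ i in 𝓝 t, ∃ z ∈ convexHull ℝ (outline (X i) (Y i) (Z i)),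
      z ∈ segment ℝ (s i) (P i) ∨ z ∈ segment ℝ (s i) (Q i) := by
  have hfs := height_hull hst
  have hn := normal_ne_zero_of_mem_hull hst hst'
  have cs := height_continuousAt hX hY hZ hs
  -- The displayed point is where the line from `s i` to `R i` meets the moving plane. At `t` the
  -- parameter is zero and the point is `s t`, interior to the triangle, so it stays interior
  -- nearby.
  have aux : ∀ {R : I → E3}, ContinuousAt R t → height (X t) (Y t) (Z t) (R t) ≠ 0 →
      ∀ᶠ i in 𝓝 t, normal (X i) (Y i) (Z i) ≠ 0 ∧ BaryPos (X i) (Y i) (Z i)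
        (s i + (height (X i) (Y i) (Z i) (s i) / (height (X i) (Y i) (Z i) (s i) -
          height (X i) (Y i) (Z i) (R i))) • (R i - s i)) := by
    intro R hR hRt
    have cR := height_continuousAt hX hY hZ hR
    refine BaryPos.eventually hX hY hZ (hs.add ((cs.div (cs.sub cR) ?_).smul (hR.sub hs))) hn ?_
    · rw [Pi.sub_apply, hfs]; simpa using hRt
    · rw [hfs]; simpa using baryPos_of_mem hst hst'
  have seg : ∀ {R : E3} {i : I}, normal (X i) (Y i) (Z i) ≠ 0 → BaryPos (X i) (Y i) (Z i)
        (s i + (height (X i) (Y i) (Z i) (s i) / (height (X i) (Y i) (Z i) (s i) -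
          height (X i) (Y i) (Z i) R)) • (R - s i)) →
      height (X i) (Y i) (Z i) (s i) - height (X i) (Y i) (Z i) R ≠ 0 →
      s i + (height (X i) (Y i) (Z i) (s i) / (height (X i) (Y i) (Z i) (s i) -
          height (X i) (Y i) (Z i) R)) • (R - s i) ∈
        convexHull ℝ (outline (X i) (Y i) (Z i)) := by
    intro R i h1 h2 h3
    refine h2.mem_hull h1 ?_
    have e : ∀ τ : ℝ, height (X i) (Y i) (Z i) (s i + τ • (R - s i)) =
        height (X i) (Y i) (Z i) (s i) -
          τ * (height (X i) (Y i) (Z i) (s i) - height (X i) (Y i) (Z i) R) := by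
      intro τ; simp [height, dot]; ring
    rw [e, div_mul_cancel₀ _ h3, sub_self]
  filter_upwards [aux hP hfP.ne, aux hQ hfQ.ne',
    (height_continuousAt hX hY hZ hP).eventually (gt_mem_nhds hfP),
    (height_continuousAt hX hY hZ hQ).eventually (lt_mem_nhds hfQ)] with i h1 h2 h3 h4
  -- Whichever side `s i` has drifted to, the leg towards the opposite side crosses the plane.
  rcases le_total 0 (height (X i) (Y i) (Z i) (s i)) with h0 | h0
  · refine ⟨_, seg h1.1 h1.2 (by linarith), Or.inl ?_⟩
    rw [segment_eq_image']
    refine ⟨_, ⟨div_nonneg h0 (by linarith), ?_⟩, rfl⟩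
    rw [div_le_one (by linarith)]; linarith
  · refine ⟨_, seg h2.1 h2.2 (by linarith), Or.inr ?_⟩
    rw [segment_eq_image']
    refine ⟨_, ⟨div_nonneg_of_nonpos h0 (by linarith), ?_⟩, rfl⟩
    rw [div_le_one_of_neg (by linarith)]; linarith

/-- Coplanar disjoint triangles are not linked. -/
theorem not_linked_of_coplanar {A B C X Y Z : E3}
    (hd : Disjoint (outline A B C) (outline X Y Z))
    (hA : height X Y Z A = 0) (hB : height X Y Z B = 0) (hC : height X Y Z C = 0) :
    ¬ Linked (outline A B C) (outline X Y Z) := by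
  rintro ⟨⟨s, hs, hs'⟩, ⟨t, ht, ht'⟩⟩
  rw [Set.disjoint_left] at hd
  -- A side of `A B C` that starts inside `X Y Z` cannot leave it without crossing its outline, so
  -- containment spreads from `s` to all three vertices.
  have step : ∀ {p q : E3}, p ∈ convexHull ℝ (outline X Y Z) → height X Y Z q = 0 →
      segment ℝ p q ⊆ outline A B C → q ∈ convexHull ℝ (outline X Y Z) :=
    fun hp hq h => mem_hull_of_segment_disjoint hp hq fun x hx => hd (h hx)
  have sAB : segment ℝ A B ⊆ outline A B C := fun x h => Or.inl (Or.inl h)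
  have sBC : segment ℝ B C ⊆ outline A B C := fun x h => Or.inl (Or.inr h)
  have sCA : segment ℝ C A ⊆ outline A B C := fun x h => Or.inr h
  have hAT : A ∈ convexHull ℝ (outline X Y Z) := by
    rcases hs with (h | h) | h
    · exact step hs' hA (((convex_segment A B).segment_subset h
        (left_mem_segment _ _ _)).trans sAB)
    · exact step (step hs' hC (((convex_segment B C).segment_subset h
        (right_mem_segment _ _ _)).trans sBC)) hA sCA
    · exact step hs' hA (((convex_segment C A).segment_subset h
        (right_mem_segment _ _ _)).trans sCA)
  have hBT := step hAT hB sAB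
  have hCT := step hBT hC sBC
  have mA : A ∉ outline X Y Z := hd (sAB (left_mem_segment _ _ _))
  have mB : B ∉ outline X Y Z := hd (sAB (right_mem_segment _ _ _))
  have mC : C ∉ outline X Y Z := hd (sCA (left_mem_segment _ _ _))
  have hn := normal_ne_zero_of_mem_hull hAT mA
  obtain ⟨a1, a2, a3, ha1, ha2, ha3, ha, rfl⟩ := exists_pos_weights hAT mA
  obtain ⟨b1, b2, b3, hb1, hb2, hb3, hb, rfl⟩ := exists_pos_weights hBT mB
  obtain ⟨c1, c2, c3, hc1, hc2, hc3, hc, rfl⟩ := exists_pos_weights hCT mC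
  -- With all vertices of one triangle interior to the other, every point of its hull has positive
  -- weights at `X`, `Y`, `Z`; a point of the outline does not.
  obtain ⟨p, q, r, hp, hq, hr, hpqr, he⟩ := mem_hull.1 ht'
  obtain ⟨x, y, z, hx, hy, hz, hxyz, h0, rfl⟩ := mem_outline.1 ht
  have e : p • (a1 • X + a2 • Y + a3 • Z) + q • (b1 • X + b2 • Y + b3 • Z) +
      r • (c1 • X + c2 • Y + c3 • Z) = (p * a1 + q * b1 + r * c1) • X +
      (p * a2 + q * b2 + r * c2) • Y + (p * a3 + q * b3 + r * c3) • Z := by module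
  rw [e] at he
  have s1 : p * a1 + q * b1 + r * c1 + (p * a2 + q * b2 + r * c2) +
      (p * a3 + q * b3 + r * c3) = 1 := by
    linear_combination hpqr + p * ha + q * hb + r * hc
  have u1 := bary_eq (A := X) (B := Y) (C := Z) hn hxyz
  have u2 := bary_eq (A := X) (B := Y) (C := Z) hn s1
  rw [he, u2.1, u2.2] at u1
  have pos : ∀ {i j k : ℝ}, 0 < i → 0 < j → 0 < k → 0 < p * i + q * j + r * k := by
    intro i j k hi hj hk
    have h1 := mul_nonneg hp hi.le
    have h2 := mul_nonneg hq hj.le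
    have h3 := mul_nonneg hr hk.le
    rcases hp.eq_or_lt with rfl | hp
    · rcases hq.eq_or_lt with rfl | hq
      · obtain rfl : r = 1 := by linarith
        linarith
      · nlinarith [mul_pos hq hj]
    · nlinarith [mul_pos hp hi]
  have q1 := pos ha1 hb1 hc1
  have q2 := pos ha2 hb2 hc2
  have q3 := pos ha3 hb3 hc3
  rcases h0 with h0 | h0 | h0 <;> linarith [u1.1, u1.2]

/-- The point of `outline X Y Z` inside `A B C` gives a relation with positive weights between the
heights of `A`, `B`, `C`, and these heights are not all zero. Hence the two legs of the outline at
the meeting point `s`, whether `s` is a vertex or lies inside a side, end strictly on opposite sides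
of the plane of `X Y Z`. -/
theorem Linked.eventually_meets {I : Type*} [TopologicalSpace I] {A B C X Y Z : I → E3} {t : I}
    (hA : ContinuousAt A t) (hB : ContinuousAt B t) (hC : ContinuousAt C t)
    (hX : ContinuousAt X t) (hY : ContinuousAt Y t) (hZ : ContinuousAt Z t)
    (hd : Disjoint (outline (A t) (B t) (C t)) (outline (X t) (Y t) (Z t)))
    (h : Linked (outline (A t) (B t) (C t)) (outline (X t) (Y t) (Z t))) :
    ∀ᶠ i in 𝓝 t, (outline (A i) (B i) (C i) ∩
      convexHull ℝ (outline (X i) (Y i) (Z i))).Nonempty := by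
  have hcop := fun h1 h2 h3 => not_linked_of_coplanar (A := A t) (B := B t) (C := C t) hd h1 h2 h3 h
  obtain ⟨⟨s, hs, hs'⟩, ⟨u, hu, hu'⟩⟩ := h
  have hsT : s ∉ outline (X t) (Y t) (Z t) := Set.disjoint_left.1 hd hs
  obtain ⟨a, b, c, ha, hb, hc, habc, rfl⟩ :=
    exists_pos_weights hu' (Set.disjoint_right.1 hd hu)
  have hf := height_hull (outline_subset_hull hu)
  rw [height_comb habc] at hf
  -- two legs of the outline of `A B C` on both sides of the plane of `X Y Z`
  have legs : ∀ {σ P Q : I → E3}, ContinuousAt σ t → ContinuousAt P t → ContinuousAt Q t →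
      σ t ∈ convexHull ℝ (outline (X t) (Y t) (Z t)) → σ t ∉ outline (X t) (Y t) (Z t) →
      height (X t) (Y t) (Z t) (P t) * height (X t) (Y t) (Z t) (Q t) < 0 →
      (∀ i, segment ℝ (σ i) (P i) ⊆ outline (A i) (B i) (C i)) →
      (∀ i, segment ℝ (σ i) (Q i) ⊆ outline (A i) (B i) (C i)) →
      ∀ᶠ i in 𝓝 t, (outline (A i) (B i) (C i) ∩
        convexHull ℝ (outline (X i) (Y i) (Z i))).Nonempty := by
    intro σ P Q hσ hP hQ h1 h2 h3 h4 h5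
    rcases mul_neg_iff.1 h3 with h3 | h3
    · filter_upwards [TriangleLinking.eventually_meets hX hY hZ hσ hQ hP h1 h2 h3.2 h3.1]
        with i ⟨z, hz, hz'⟩
      exact ⟨z, hz'.elim (fun k => h5 i k) (fun k => h4 i k), hz⟩
    · filter_upwards [TriangleLinking.eventually_meets hX hY hZ hσ hP hQ h1 h2 h3.1 h3.2]
        with i ⟨z, hz, hz'⟩
      exact ⟨z, hz'.elim (fun k => h4 i k) (fun k => h5 i k), hz⟩
  have sAB : ∀ i, segment ℝ (A i) (B i) ⊆ outline (A i) (B i) (C i) :=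
    fun i x h => Or.inl (Or.inl h)
  have sBC : ∀ i, segment ℝ (B i) (C i) ⊆ outline (A i) (B i) (C i) :=
    fun i x h => Or.inl (Or.inr h)
  have sCA : ∀ i, segment ℝ (C i) (A i) ⊆ outline (A i) (B i) (C i) := fun i x h => Or.inr h
  have neg_or : ∀ {p q f g : ℝ}, 0 < p → 0 < q → p * f + q * g = 0 → f * g < 0 ∨ f = 0 ∧ g = 0 := by
    intro p q f g hp hq h
    by_cases hf0 : f = 0
    · subst hf0
      exact Or.inr ⟨rfl, by simpa [hq.ne'] using h⟩
    · left
      have : g = -(p / q) * f := by field_simp; linarith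
      have h1 : 0 < f * f := mul_self_pos.2 hf0
      have h2 : 0 < p / q := by positivity
      rw [this]; nlinarith [mul_pos h1 h2]
  have edge : ∀ {P Q : I → E3}, ContinuousAt P t → ContinuousAt Q t →
      (∀ i, segment ℝ (P i) (Q i) ⊆ outline (A i) (B i) (C i)) →
      ∀ p q : ℝ, 0 < p → 0 < q → p + q = 1 → s = p • P t + q • Q t →
      ¬ (height (X t) (Y t) (Z t) (P t) = 0 ∧ height (X t) (Y t) (Z t) (Q t) = 0) →
      ∀ᶠ i in 𝓝 t, (outline (A i) (B i) (C i) ∩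
        convexHull ℝ (outline (X i) (Y i) (Z i))).Nonempty := by
    intro P Q hP hQ hsub p q hp hq hpq hspq hne
    have h0 := height_hull hs'
    have e : s = p • P t + q • Q t + (0 : ℝ) • Q t := by rw [hspq]; simp
    rw [e, height_comb (by linarith)] at h0
    have hm : ∀ i, p • P i + q • Q i ∈ segment ℝ (P i) (Q i) :=
      fun i => ⟨p, q, hp.le, hq.le, hpq, rfl⟩
    refine legs (σ := fun i => p • P i + q • Q i) ((hP.const_smul p).add (hQ.const_smul q)) hP hQ
      (hspq ▸ hs') (hspq ▸ hsT) ((neg_or hp hq (by linarith)).resolve_right hne) ?_ ?_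
    · exact fun i => ((convex_segment _ _).segment_subset (hm i)
        (left_mem_segment _ _ _)).trans (hsub i)
    · exact fun i => ((convex_segment _ _).segment_subset (hm i)
        (right_mem_segment _ _ _)).trans (hsub i)
  have hcA : s = A t → ∀ᶠ i in 𝓝 t, (outline (A i) (B i) (C i) ∩
        convexHull ℝ (outline (X i) (Y i) (Z i))).Nonempty := by
    intro hsA
    have h0 := height_hull hs'
    rw [hsA] at h0 hs' hsT
    rw [h0] at hf
    refine legs hA hB hC hs' hsT ((neg_or hb hc (by linarith)).resolve_right
      fun h => hcop h0 h.1 h.2) sAB fun i => ?_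
    rw [segment_symm]; exact sCA i
  have hcB : s = B t → ∀ᶠ i in 𝓝 t, (outline (A i) (B i) (C i) ∩
        convexHull ℝ (outline (X i) (Y i) (Z i))).Nonempty := by
    intro hsB
    have h0 := height_hull hs'
    rw [hsB] at h0 hs' hsT
    rw [h0] at hf
    refine legs hB hC hA hs' hsT ((neg_or hc ha (by linarith)).resolve_right
      fun h => hcop h.2 h0 h.1) sBC fun i => ?_
    rw [segment_symm]; exact sAB i
  have hcC : s = C t → ∀ᶠ i in 𝓝 t, (outline (A i) (B i) (C i) ∩
        convexHull ℝ (outline (X i) (Y i) (Z i))).Nonempty := by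
    intro hsC
    have h0 := height_hull hs'
    rw [hsC] at h0 hs' hsT
    rw [h0] at hf
    refine legs hC hA hB hs' hsT ((neg_or ha hb (by linarith)).resolve_right
      fun h => hcop h.1 h.2 h0) sCA fun i => ?_
    rw [segment_symm]; exact sBC i
  have split : ∀ {P Q : E3}, s ∈ segment ℝ P Q → s = P ∨ s = Q ∨
      ∃ p q : ℝ, 0 < p ∧ 0 < q ∧ p + q = 1 ∧ s = p • P + q • Q := by
    rintro P Q ⟨p, q, hp, hq, hpq, rfl⟩
    rcases hp.eq_or_lt with rfl | hp
    · obtain rfl : q = 1 := by linarith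
      simp
    rcases hq.eq_or_lt with rfl | hq
    · obtain rfl : p = 1 := by linarith
      simp
    exact Or.inr (Or.inr ⟨p, q, hp, hq, hpq, rfl⟩)
  rcases hs with (hs | hs) | hs
  · rcases split hs with h | h | ⟨p, q, hp, hq, hpq, h⟩
    · exact hcA h
    · exact hcB h
    · exact edge hA hB sAB p q hp hq hpq h fun hh => hcop hh.1 hh.2 (by
        rw [hh.1, hh.2] at hf; simpa [hc.ne'] using hf)
  · rcases split hs with h | h | ⟨p, q, hp, hq, hpq, h⟩
    · exact hcB h
    · exact hcC h
    · exact edge hB hC sBC p q hp hq hpq h fun hh => hcop (by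
        rw [hh.1, hh.2] at hf; simpa [ha.ne'] using hf) hh.1 hh.2
  · rcases split hs with h | h | ⟨p, q, hp, hq, hpq, h⟩
    · exact hcC h
    · exact hcA h
    · exact edge hC hA sCA p q hp hq hpq h fun hh => hcop hh.2 (by
        rw [hh.1, hh.2] at hf; simpa [hb.ne'] using hf) hh.1

/-! ### The Borromean pattern and its triple point -/

/-- The cyclic overlapping pattern of the Borromean rings. -/
def BorromeanTriple (S T U : Set E3) : Prop :=
  S ∩ convexHull ℝ T = ∅ ∧ T ∩ convexHull ℝ U = ∅ ∧ U ∩ convexHull ℝ S = ∅ ∧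
    (convexHull ℝ S ∩ (convexHull ℝ T ∩ convexHull ℝ U)).Nonempty

theorem BorromeanTriple.rotate {S T U : Set E3} (h : BorromeanTriple S T U) :
    BorromeanTriple T U S := by
  obtain ⟨h1, h2, h3, x, h4, h5, h6⟩ := h
  exact ⟨h2, h3, h1, x, h5, h6, h4⟩

/-- Along a ray parallel to all three planes, the three emptiness conditions force the exit times to
satisfy `b < a`, `c < b` and `a < c`. Degenerate triangles, whose normal is zero, are excluded by
the same argument. -/
theorem BorromeanTriple.triple_ne_zero {A B C X Y Z K L M : E3}
    (h : BorromeanTriple (outline A B C) (outline X Y Z) (outline K L M)) :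
    triple (normal A B C) (normal X Y Z) (normal K L M) ≠ 0 := by
  intro h0
  obtain ⟨v, hv, v1, v2, v3⟩ := exists_common_direction h0
  obtain ⟨h1, h2, h3, o, o1, o2, o3⟩ := h
  obtain ⟨a, ha, ha'⟩ := exists_exit o1 hv v1
  obtain ⟨b, hb, hb'⟩ := exists_exit o2 hv v2
  obtain ⟨c, hc, hc'⟩ := exists_exit o3 hv v3
  have k1 : b < a := by
    by_contra! hab
    exact Set.eq_empty_iff_forall_notMem.1 h1 _ ⟨ha', exit_mem_hull o2 hb' ha hab⟩
  have k2 : c < b := by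
    by_contra! hab
    exact Set.eq_empty_iff_forall_notMem.1 h2 _ ⟨hb', exit_mem_hull o3 hc' hb hab⟩
  have k3 : a < c := by
    by_contra! hab
    exact Set.eq_empty_iff_forall_notMem.1 h3 _ ⟨hc', exit_mem_hull o1 ha' hc hab⟩
  linarith

/-- The cross product. -/
noncomputable def cross (x y : E3) : E3 :=
  !₂[x 1 * y 2 - x 2 * y 1, x 2 * y 0 - x 0 * y 2, x 0 * y 1 - x 1 * y 0]

theorem cross_continuousAt {I : Type*} [TopologicalSpace I] {x y : I → E3} {t : I}
    (hx : ContinuousAt x t) (hy : ContinuousAt y t) :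
    ContinuousAt (fun i => cross (x i) (y i)) t := by
  have := normal_continuousAt (A := fun _ => 0) continuousAt_const hx hy
  simpa [cross, normal] using this

/-- Cramer's rule for the common point of three planes with normals `x`, `y`, `z`. -/
noncomputable def cramer (x y z : E3) (a b c : ℝ) : E3 :=
  (triple x y z)⁻¹ • (a • cross y z + b • cross z x + c • cross x y)

theorem dot_cramer {x y z : E3} (h : triple x y z ≠ 0) (a b c : ℝ) :
    dot x (cramer x y z a b c) = a ∧ dot y (cramer x y z a b c) = b ∧
      dot z (cramer x y z a b c) = c := by
  refine ⟨?_, ?_, ?_⟩ <;> (simp [dot, cramer, cross]; field_simp; unfold triple; ring)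

theorem cramer_dot {x y z : E3} (h : triple x y z ≠ 0) (o : E3) :
    cramer x y z (dot x o) (dot y o) (dot z o) = o := by
  ext i
  fin_cases i <;> (simp [dot, cramer, cross]; field_simp; unfold triple; ring)

/-- Cramer's rule makes the common point of the three planes continuous near `t`. At `t` it lies on
none of the outlines, so it is interior to all three triangles and remains so. -/
theorem BorromeanTriple.eventually_triple_point {I : Type*} [TopologicalSpace I]
    {A B C X Y Z K L M : I → E3} {t : I}
    (hA : ContinuousAt A t) (hB : ContinuousAt B t) (hC : ContinuousAt C t)
    (hX : ContinuousAt X t) (hY : ContinuousAt Y t) (hZ : ContinuousAt Z t)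
    (hK : ContinuousAt K t) (hL : ContinuousAt L t) (hM : ContinuousAt M t)
    (h : BorromeanTriple (outline (A t) (B t) (C t)) (outline (X t) (Y t) (Z t))
      (outline (K t) (L t) (M t))) :
    ∀ᶠ i in 𝓝 t, (convexHull ℝ (outline (A i) (B i) (C i)) ∩
      (convexHull ℝ (outline (X i) (Y i) (Z i)) ∩
        convexHull ℝ (outline (K i) (L i) (M i)))).Nonempty := by
  have h0 := h.triple_ne_zero
  obtain ⟨h1, h2, h3, o, o1, o2, o3⟩ := h
  have n1 := normal_continuousAt hA hB hC
  have n2 := normal_continuousAt hX hY hZ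
  have n3 := normal_continuousAt hK hL hM
  have cd : ContinuousAt (fun i => triple (normal (A i) (B i) (C i)) (normal (X i) (Y i) (Z i))
      (normal (K i) (L i) (M i))) t := by
    have e : ∀ x y z : E3, triple x y z = dot x (cross y z) := fun x y z => by
      simp [triple, dot, cross]
    simp only [e]
    exact dot_continuousAt n1 (cross_continuousAt n2 n3)
  let w : I → E3 := fun i => cramer (normal (A i) (B i) (C i)) (normal (X i) (Y i) (Z i))
      (normal (K i) (L i) (M i)) (dot (normal (A i) (B i) (C i)) (A i))
      (dot (normal (X i) (Y i) (Z i)) (X i)) (dot (normal (K i) (L i) (M i)) (K i))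
  have cw : ContinuousAt w t :=
    (cd.inv₀ h0).smul ((((dot_continuousAt n1 hA).smul (cross_continuousAt n2 n3)).add
      ((dot_continuousAt n2 hX).smul (cross_continuousAt n3 n1))).add
      ((dot_continuousAt n3 hK).smul (cross_continuousAt n1 n2)))
  have sub : ∀ n x y : E3, dot n (x - y) = dot n x - dot n y := fun n x y => by
    simp [dot]; ring
  have wt : w t = o := by
    have k1 := height_hull o1
    have k2 := height_hull o2
    have k3 := height_hull o3
    simp only [height, sub, sub_eq_zero] at k1 k2 k3
    simp only [w]
    rw [← k1, ← k2, ← k3, cramer_dot h0]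
  have m1 : o ∉ outline (A t) (B t) (C t) := fun hh =>
    Set.eq_empty_iff_forall_notMem.1 h1 _ ⟨hh, o2⟩
  have m2 : o ∉ outline (X t) (Y t) (Z t) := fun hh =>
    Set.eq_empty_iff_forall_notMem.1 h2 _ ⟨hh, o3⟩
  have m3 : o ∉ outline (K t) (L t) (M t) := fun hh =>
    Set.eq_empty_iff_forall_notMem.1 h3 _ ⟨hh, o1⟩
  filter_upwards [cd.eventually_ne h0,
    BaryPos.eventually hA hB hC cw (normal_ne_zero_of_mem_hull o1 m1)
      (wt ▸ baryPos_of_mem o1 m1),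
    BaryPos.eventually hX hY hZ cw (normal_ne_zero_of_mem_hull o2 m2)
      (wt ▸ baryPos_of_mem o2 m2),
    BaryPos.eventually hK hL hM cw (normal_ne_zero_of_mem_hull o3 m3)
      (wt ▸ baryPos_of_mem o3 m3)] with i i0 i1 i2 i3
  obtain ⟨d1, d2, d3⟩ := dot_cramer i0 (dot (normal (A i) (B i) (C i)) (A i))
      (dot (normal (X i) (Y i) (Z i)) (X i)) (dot (normal (K i) (L i) (M i)) (K i))
  refine ⟨w i, i1.2.mem_hull i1.1 ?_, i2.2.mem_hull i2.1 ?_, i3.2.mem_hull i3.1 ?_⟩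
  · rw [height, sub, d1, sub_self]
  · rw [height, sub, d2, sub_self]
  · rw [height, sub, d3, sub_self]

/-! ### Closedness from compactness of the weights -/

/-- The set is the projection of a closed subset of `I × W` along the compact factor `W`. -/
theorem isClosed_meets_of_weights {I : Type*} [TopologicalSpace I] {A B C : I → E3}
    (hA : Continuous A) (hB : Continuous B) (hC : Continuous C) {W : Set (ℝ × ℝ × ℝ)}
    (hW : IsCompact W) {F : Set E3} (hF : IsClosed F) :
    IsClosed {i | ∃ w ∈ W, w.1 • A i + w.2.1 • B i + w.2.2 • C i ∈ F} := by
  have : CompactSpace W := isCompact_iff_compactSpace.1 hW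
  have hc : Continuous fun p : I × W =>
      (p.2 : ℝ × ℝ × ℝ).1 • A p.1 + (p.2 : ℝ × ℝ × ℝ).2.1 • B p.1 +
        (p.2 : ℝ × ℝ × ℝ).2.2 • C p.1 := by fun_prop
  have h := isClosedMap_fst_of_compactSpace _ (hF.preimage hc)
  convert h using 1
  ext i
  simp

/-- The weights of the points of a triangle. -/
def hullWeights : Set (ℝ × ℝ × ℝ) :=
  {w | 0 ≤ w.1 ∧ 0 ≤ w.2.1 ∧ 0 ≤ w.2.2 ∧ w.1 + w.2.1 + w.2.2 = 1}

/-- The weights of the points of the outline of a triangle. -/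
def outlineWeights : Set (ℝ × ℝ × ℝ) :=
  hullWeights ∩ {w | w.1 = 0 ∨ w.2.1 = 0 ∨ w.2.2 = 0}

theorem isCompact_hullWeights : IsCompact hullWeights := by
  have h1 : IsClosed {w : ℝ × ℝ × ℝ | 0 ≤ w.1} := isClosed_le continuous_const (by fun_prop)
  have h2 : IsClosed {w : ℝ × ℝ × ℝ | 0 ≤ w.2.1} := isClosed_le continuous_const (by fun_prop)
  have h3 : IsClosed {w : ℝ × ℝ × ℝ | 0 ≤ w.2.2} := isClosed_le continuous_const (by fun_prop)
  have h4 : IsClosed {w : ℝ × ℝ × ℝ | w.1 + w.2.1 + w.2.2 = 1} :=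
    isClosed_eq (by fun_prop) continuous_const
  refine (isCompact_Icc (a := ((0, 0, 0) : ℝ × ℝ × ℝ)) (b := (1, 1, 1))).of_isClosed_subset
    (h1.inter (h2.inter (h3.inter h4))) ?_
  rintro ⟨a, b, c⟩ ⟨ha, hb, hc, h⟩
  simp only at ha hb hc h
  exact ⟨⟨ha, hb, hc⟩, ⟨by simp only; linarith, by simp only; linarith, by simp only; linarith⟩⟩

theorem isCompact_outlineWeights : IsCompact outlineWeights := by
  have h1 : IsClosed {w : ℝ × ℝ × ℝ | w.1 = 0} := isClosed_eq (by fun_prop) continuous_const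
  have h2 : IsClosed {w : ℝ × ℝ × ℝ | w.2.1 = 0} := isClosed_eq (by fun_prop) continuous_const
  have h3 : IsClosed {w : ℝ × ℝ × ℝ | w.2.2 = 0} := isClosed_eq (by fun_prop) continuous_const
  exact isCompact_hullWeights.inter_right (h1.union (h2.union h3))

theorem isClosed_hull_meets {I : Type*} [TopologicalSpace I] {A B C : I → E3}
    (hA : Continuous A) (hB : Continuous B) (hC : Continuous C) {F : Set E3} (hF : IsClosed F) :
    IsClosed {i | (convexHull ℝ (outline (A i) (B i) (C i)) ∩ F).Nonempty} := by
  convert isClosed_meets_of_weights hA hB hC isCompact_hullWeights hF using 1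
  ext i
  constructor
  · rintro ⟨x, hx, hF⟩
    obtain ⟨a, b, c, ha, hb, hc, h, rfl⟩ := mem_hull.1 hx
    exact ⟨(a, b, c), ⟨ha, hb, hc, h⟩, hF⟩
  · rintro ⟨⟨a, b, c⟩, ⟨ha, hb, hc, h⟩, hF⟩
    exact ⟨_, mem_hull.2 ⟨a, b, c, ha, hb, hc, h, rfl⟩, hF⟩

theorem isClosed_outline_meets {I : Type*} [TopologicalSpace I] {A B C : I → E3}
    (hA : Continuous A) (hB : Continuous B) (hC : Continuous C) {F : Set E3} (hF : IsClosed F) :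
    IsClosed {i | (outline (A i) (B i) (C i) ∩ F).Nonempty} := by
  convert isClosed_meets_of_weights hA hB hC isCompact_outlineWeights hF using 1
  ext i
  constructor
  · rintro ⟨x, hx, hF⟩
    obtain ⟨a, b, c, ha, hb, hc, h, h0, rfl⟩ := mem_outline.1 hx
    exact ⟨(a, b, c), ⟨⟨ha, hb, hc, h⟩, h0⟩, hF⟩
  · rintro ⟨⟨a, b, c⟩, ⟨⟨ha, hb, hc, h⟩, h0⟩, hF⟩
    exact ⟨_, mem_outline.2 ⟨a, b, c, ha, hb, hc, h, h0, rfl⟩, hF⟩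

theorem IsLoop.isClosed {T : Set E3} (h : IsLoop T) : IsClosed T := by
  obtain ⟨A, B, C, rfl⟩ := h
  have h : outline A B C =
      (fun w : ℝ × ℝ × ℝ => w.1 • A + w.2.1 • B + w.2.2 • C) '' outlineWeights := by
    ext x
    simp only [mem_outline, outlineWeights, hullWeights, Set.mem_image, Prod.exists]
    constructor
    · rintro ⟨a, b, c, ha, hb, hc, h, h0, rfl⟩
      exact ⟨a, b, c, ⟨⟨ha, hb, hc, h⟩, h0⟩, rfl⟩
    · rintro ⟨a, b, c, ⟨⟨ha, hb, hc, h⟩, h0⟩, rfl⟩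
      exact ⟨a, b, c, ha, hb, hc, h, h0, rfl⟩
  rw [h]
  exact (isCompact_outlineWeights.image (by fun_prop)).isClosed

theorem IsLoop.isClosed_hull {T : Set E3} (h : IsLoop T) : IsClosed (convexHull ℝ T) := by
  obtain ⟨A, B, C, rfl⟩ := h
  have h : convexHull ℝ (outline A B C) =
      (fun w : ℝ × ℝ × ℝ => w.1 • A + w.2.1 • B + w.2.2 • C) '' hullWeights := by
    ext x
    simp only [mem_hull, hullWeights, Set.mem_image, Prod.exists]
    constructor
    · rintro ⟨a, b, c, ha, hb, hc, h, rfl⟩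
      exact ⟨a, b, c, ⟨ha, hb, hc, h⟩, rfl⟩
    · rintro ⟨a, b, c, ⟨ha, hb, hc, h⟩, rfl⟩
      exact ⟨a, b, c, ha, hb, hc, h, rfl⟩
  rw [h]
  exact (isCompact_hullWeights.image (by fun_prop)).isClosed

/-! ### Constancy of linking and of the Borromean pattern -/

theorem isClopen_linked {I : Type*} [TopologicalSpace I] {A B C : I → E3}
    (hA : Continuous A) (hB : Continuous B) (hC : Continuous C) {T : Set E3} (hT : IsLoop T)
    (hd : ∀ i, Disjoint (outline (A i) (B i) (C i)) T) :
    IsClopen {i | Linked (outline (A i) (B i) (C i)) T} := by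
  refine ⟨?_, isOpen_iff_mem_nhds.2 fun t ht => ?_⟩
  · convert (isClosed_outline_meets hA hB hC hT.isClosed_hull).inter
      (isClosed_hull_meets hA hB hC hT.isClosed) using 1
    ext i
    simp [Linked, Set.inter_comm T]
  · obtain ⟨X, Y, Z, rfl⟩ := hT
    have h1 := Linked.eventually_meets (t := t) hA.continuousAt hB.continuousAt hC.continuousAt
      (X := fun _ => X) (Y := fun _ => Y) (Z := fun _ => Z) continuousAt_const continuousAt_const
      continuousAt_const (hd t) ht
    have h2 := Linked.eventually_meets (t := t) (A := fun _ => X) (B := fun _ => Y)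
      (C := fun _ => Z) continuousAt_const continuousAt_const continuousAt_const
      hA.continuousAt hB.continuousAt hC.continuousAt (hd t).symm ht.symm
    filter_upwards [h1, h2] with i k1 k2 using ⟨k1, k2⟩

theorem BorromeanTriple.meets {S T U : Set E3} (hS : IsLoop S) (hT : IsLoop T)
    (h : BorromeanTriple S T U) : (T ∩ convexHull ℝ S).Nonempty := by
  obtain ⟨h1, -, -, x, h4, h5, -⟩ := h
  exact (meets_or_meets hS hT ⟨x, h4, h5⟩).resolve_left fun h => h.ne_empty h1

/-- If the pattern occurs at one parameter, the moving loop is unlinked there with `T` and with `U`,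
hence always. The two conditions on it then become the closed ones `cT'` and `cU`:
`BorromeanTriple.meets` gives one direction, unlinkedness the other. -/
theorem isClopen_borromeanTriple {I : Type*} [TopologicalSpace I] [PreconnectedSpace I]
    {A B C : I → E3} (hA : Continuous A) (hB : Continuous B) (hC : Continuous C) {T U : Set E3}
    (hT : IsLoop T) (hU : IsLoop U) (hdT : ∀ i, Disjoint (outline (A i) (B i) (C i)) T)
    (hdU : ∀ i, Disjoint (outline (A i) (B i) (C i)) U) :
    IsClopen {i | BorromeanTriple (outline (A i) (B i) (C i)) T U} := by
  have hS : ∀ i, IsLoop (outline (A i) (B i) (C i)) := fun i => ⟨_, _, _, rfl⟩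
  have cT := isClosed_outline_meets hA hB hC hT.isClosed_hull
  have cT' := isClosed_hull_meets hA hB hC hT.isClosed
  have cU := isClosed_outline_meets hA hB hC hU.isClosed_hull
  have cU' := isClosed_hull_meets hA hB hC hU.isClosed
  have c3 := isClosed_hull_meets hA hB hC (hT.isClosed_hull.inter hU.isClosed_hull)
  refine ⟨?_, isOpen_iff_mem_nhds.2 fun t ht => ?_⟩
  · by_cases hne : {i | BorromeanTriple (outline (A i) (B i) (C i)) T U} = ∅
    · rw [hne]; exact isClosed_empty
    obtain ⟨j, hj⟩ := Set.nonempty_iff_ne_empty.2 hne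
    have nT : ∀ i, ¬ Linked (outline (A i) (B i) (C i)) T := by
      rcases isClopen_iff.1 (isClopen_linked hA hB hC hT hdT) with h | h
      · exact fun i hi => Set.eq_empty_iff_forall_notMem.1 h i hi
      · have hl : Linked _ T := Set.eq_univ_iff_forall.1 h j
        exact absurd hj.1 hl.1.ne_empty
    have nU : ∀ i, ¬ Linked (outline (A i) (B i) (C i)) U := by
      rcases isClopen_iff.1 (isClopen_linked hA hB hC hU hdU) with h | h
      · exact fun i hi => Set.eq_empty_iff_forall_notMem.1 h i hi
      · have hl : Linked _ U := Set.eq_univ_iff_forall.1 h j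
        exact absurd hj.2.2.1 hl.2.ne_empty
    convert (cT'.inter cU).inter c3 using 1
    ext i
    constructor
    · intro h
      refine ⟨⟨?_, ?_⟩, h.2.2.2⟩
      · simpa [Set.inter_comm T] using h.meets (hS i) hT
      · exact h.rotate.rotate.meets hU (hS i)
    · rintro ⟨⟨h1, h2⟩, h3⟩
      simp only [Set.mem_ofPred_eq] at h1 h2
      refine ⟨?_, hj.2.1, ?_, h3⟩
      · by_contra h
        exact nT i ⟨Set.nonempty_iff_ne_empty.2 h, by rwa [Set.inter_comm]⟩
      · by_contra h
        exact nU i ⟨h2, Set.nonempty_iff_ne_empty.2 h⟩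
  · have e1 := cT.isOpen_compl.mem_nhds (x := t) (by
      simpa using Set.not_nonempty_iff_eq_empty.2 ht.1)
    have e2 := cU'.isOpen_compl.mem_nhds (x := t) (by
      rw [Set.mem_compl_iff, Set.mem_ofPred_eq, Set.inter_comm]
      exact Set.not_nonempty_iff_eq_empty.2 ht.2.2.1)
    obtain ⟨X, Y, Z, rfl⟩ := hT
    obtain ⟨K, L, M, rfl⟩ := hU
    have e3 := BorromeanTriple.eventually_triple_point (t := t) hA.continuousAt hB.continuousAt
      hC.continuousAt (X := fun _ => X) (Y := fun _ => Y) (Z := fun _ => Z) continuousAt_const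
      continuousAt_const continuousAt_const (K := fun _ => K) (L := fun _ => L) (M := fun _ => M)
      continuousAt_const continuousAt_const continuousAt_const ht
    filter_upwards [e1, e2, e3] with i k1 k2 k3
    refine ⟨Set.not_nonempty_iff_eq_empty.1 k1, ht.2.1, ?_, k3⟩
    rw [Set.inter_comm]
    exact Set.not_nonempty_iff_eq_empty.1 k2

theorem IsClopen.mem_iff {I : Type*} [TopologicalSpace I] [PreconnectedSpace I] {s : Set I}
    (h : IsClopen s) (x y : I) : x ∈ s ↔ y ∈ s := by
  rcases isClopen_iff.1 h with rfl | rfl <;> simp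

/-! ### Elementary moves as continuous paths -/

/-- The position of a vertex that moves linearly from `C` to `C'`. -/
noncomputable def vertexPath (C C' : E3) (t : unitInterval) : E3 :=
  (1 - (t : ℝ)) • C + (t : ℝ) • C'

theorem vertexPath_continuous (C C' : E3) : Continuous (vertexPath C C') := by
  unfold vertexPath; fun_prop

/-- The two moving sides sweep only the hulls of `A C C'` and `B C C'`. The intermediate triangle
may degenerate when the segment from `C` to `C'` crosses the line `A B`. -/
theorem outline_vertexPath_subset (A B C C' : E3) (t : unitInterval) :
    outline A B (vertexPath C C' t) ⊆
      outline A B C ∪ (convexHull ℝ {A, C, C'} ∪ convexHull ℝ {B, C, C'}) := by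
  have hv : ∀ P : E3, vertexPath C C' t ∈ convexHull ℝ ({P, C, C'} : Set E3) := fun P =>
    (convex_convexHull ℝ _) (subset_convexHull _ _ (by simp)) (subset_convexHull _ _ (by simp))
      (sub_nonneg.2 t.2.2) t.2.1 (by ring)
  have hP : ∀ P : E3, P ∈ convexHull ℝ ({P, C, C'} : Set E3) := fun P =>
    subset_convexHull _ _ (by simp)
  rintro x ((h | h) | h)
  · exact Or.inl (Or.inl (Or.inl h))
  · exact Or.inr (Or.inr ((convex_convexHull ℝ _).segment_subset (hP B) (hv B) h))
  · exact Or.inr (Or.inl ((convex_convexHull ℝ _).segment_subset (hv A) (hP A) h))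

/-- The third vertex of `A B C` moves to `C'` avoiding `T`. -/
def MoveAvoids (A B C C' : E3) (T : Set E3) : Prop :=
  (convexHull ℝ {A, C, C'} ∪ convexHull ℝ {B, C, C'}) ∩ T = ∅

theorem MoveAvoids.disjoint {A B C C' : E3} {T : Set E3} (h : MoveAvoids A B C C' T)
    (hd : Disjoint (outline A B C) T) (t : unitInterval) :
    Disjoint (outline A B (vertexPath C C' t)) T :=
  Disjoint.mono_left (outline_vertexPath_subset A B C C' t)
    (hd.sup_left (Set.disjoint_iff_inter_eq_empty.2 h))

theorem vertexPath_zero (C C' : E3) : vertexPath C C' 0 = C := by simp [vertexPath]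

theorem vertexPath_one (C C' : E3) : vertexPath C C' 1 = C' := by simp [vertexPath]

theorem MoveAvoids.linked_iff {A B C C' : E3} {T : Set E3} (h : MoveAvoids A B C C' T)
    (hT : IsLoop T) (hd : Disjoint (outline A B C) T) :
    Linked (outline A B C) T ↔ Linked (outline A B C') T := by
  have := IsClopen.mem_iff (isClopen_linked (A := fun _ => A) (B := fun _ => B) continuous_const
    continuous_const (vertexPath_continuous C C') hT (h.disjoint hd)) 0 1
  simpa only [Set.mem_ofPred_eq, vertexPath_zero, vertexPath_one] using this

theorem MoveAvoids.borromeanTriple_iff {A B C C' : E3} {T U : Set E3}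
    (hT : MoveAvoids A B C C' T) (hU : MoveAvoids A B C C' U) (lT : IsLoop T) (lU : IsLoop U)
    (dT : Disjoint (outline A B C) T) (dU : Disjoint (outline A B C) U) :
    BorromeanTriple (outline A B C) T U ↔ BorromeanTriple (outline A B C') T U := by
  have := IsClopen.mem_iff (isClopen_borromeanTriple (A := fun _ => A) (B := fun _ => B)
    continuous_const continuous_const (vertexPath_continuous C C') lT lU (hT.disjoint dT)
    (hU.disjoint dU)) 0 1
  simpa only [Set.mem_ofPred_eq, vertexPath_zero, vertexPath_one] using this

/-! ### Invariants of unordered linkings -/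

/-- Three pairwise disjoint loops. -/
structure LoopTriple (S T U : Set E3) : Prop where
  loop₁ : IsLoop S
  loop₂ : IsLoop T
  loop₃ : IsLoop U
  disj₁₂ : Disjoint S T
  disj₁₃ : Disjoint S U
  disj₂₃ : Disjoint T U

theorem LoopTriple.rotate {S T U : Set E3} (h : LoopTriple S T U) : LoopTriple T U S :=
  ⟨h.loop₂, h.loop₃, h.loop₁, h.disj₂₃, h.disj₁₂.symm, h.disj₁₃.symm⟩

theorem IsLoop.nonempty {T : Set E3} (h : IsLoop T) : T.Nonempty := by
  obtain ⟨A, B, C, rfl⟩ := h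
  exact ⟨A, Or.inl (Or.inl (left_mem_segment _ _ _))⟩

theorem IsLoop.ne_of_disjoint {S T : Set E3} (h : IsLoop S) (hd : Disjoint S T) : S ≠ T := by
  rintro rfl
  exact h.nonempty.ne_empty (disjoint_self.1 hd)

/-- Some two components are linked. -/
def SomeLinked (L : Set (Set E3)) : Prop := ∃ S ∈ L, ∃ T ∈ L, S ≠ T ∧ Linked S T

/-- Some component is linked with all other ones. -/
def HasCenter (L : Set (Set E3)) : Prop := ∃ S ∈ L, ∀ T ∈ L, S ≠ T → Linked S T

/-- All components are linked with each other. -/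
def AllLinked (L : Set (Set E3)) : Prop := ∀ S ∈ L, ∀ T ∈ L, S ≠ T → Linked S T

/-- Some three components form a Borromean pattern. -/
def IsBorromean (L : Set (Set E3)) : Prop :=
  ∃ S ∈ L, ∃ T ∈ L, ∃ U ∈ L, BorromeanTriple S T U

theorem LoopTriple.someLinked_iff {S T U : Set E3} (h : LoopTriple S T U) :
    SomeLinked {S, T, U} ↔ Linked S T ∨ Linked S U ∨ Linked T U := by
  have h1 := h.loop₁.ne_of_disjoint h.disj₁₂
  have h2 := h.loop₁.ne_of_disjoint h.disj₁₃
  have h3 := h.loop₂.ne_of_disjoint h.disj₂₃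
  simp [SomeLinked, h1, h2, h3, h1.symm, h2.symm, h3.symm, linked_comm (S := T) (T := S),
    linked_comm (S := U) (T := S), linked_comm (S := U) (T := T)]
  tauto

theorem LoopTriple.hasCenter_iff {S T U : Set E3} (h : LoopTriple S T U) :
    HasCenter {S, T, U} ↔ (Linked S T ∧ Linked S U) ∨ (Linked S T ∧ Linked T U) ∨
      (Linked S U ∧ Linked T U) := by
  have h1 := h.loop₁.ne_of_disjoint h.disj₁₂
  have h2 := h.loop₁.ne_of_disjoint h.disj₁₃
  have h3 := h.loop₂.ne_of_disjoint h.disj₂₃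
  simp [HasCenter, h1, h2, h3, h1.symm, h2.symm, h3.symm, linked_comm (S := T) (T := S),
    linked_comm (S := U) (T := S), linked_comm (S := U) (T := T)]

theorem LoopTriple.allLinked_iff {S T U : Set E3} (h : LoopTriple S T U) :
    AllLinked {S, T, U} ↔ Linked S T ∧ Linked S U ∧ Linked T U := by
  have h1 := h.loop₁.ne_of_disjoint h.disj₁₂
  have h2 := h.loop₁.ne_of_disjoint h.disj₁₃
  have h3 := h.loop₂.ne_of_disjoint h.disj₂₃
  simp [AllLinked, h1, h2, h3, h1.symm, h2.symm, h3.symm, linked_comm (S := T) (T := S),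
    linked_comm (S := U) (T := S), linked_comm (S := U) (T := T)]
  tauto

theorem not_borromeanTriple_self {S T : Set E3} (h : S.Nonempty) : ¬ BorromeanTriple S S T := by
  rintro ⟨h1, -⟩
  obtain ⟨x, hx⟩ := h
  exact Set.eq_empty_iff_forall_notMem.1 h1 x ⟨hx, subset_convexHull ℝ S hx⟩

/-- The pattern excludes repeated components and is invariant under rotation, so only the two cyclic
orders remain. -/
theorem LoopTriple.isBorromean_iff {S T U : Set E3} (h : LoopTriple S T U) :
    IsBorromean {S, T, U} ↔ BorromeanTriple S T U ∨ BorromeanTriple S U T := by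
  have n : ∀ {X Y : Set E3}, IsLoop X → ¬ BorromeanTriple X X Y ∧ ¬ BorromeanTriple X Y X ∧
      ¬ BorromeanTriple Y X X := fun hX =>
    ⟨not_borromeanTriple_self hX.nonempty,
      fun h => not_borromeanTriple_self hX.nonempty h.rotate.rotate,
      fun h => not_borromeanTriple_self hX.nonempty h.rotate⟩
  constructor
  · rintro ⟨X, hX, Y, hY, Z, hZ, hB⟩
    have nS := fun Y => n (Y := Y) h.loop₁
    have nT := fun Y => n (Y := Y) h.loop₂
    have nU := fun Y => n (Y := Y) h.loop₃
    rcases hX with rfl | rfl | rfl <;> rcases hY with rfl | rfl | rfl <;>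
      rcases hZ with rfl | rfl | rfl <;>
      first
      | exact absurd hB (nS _).1
      | exact absurd hB (nS _).2.1
      | exact absurd hB (nS _).2.2
      | exact absurd hB (nT _).1
      | exact absurd hB (nT _).2.1
      | exact absurd hB (nT _).2.2
      | exact absurd hB (nU _).1
      | exact absurd hB (nU _).2.1
      | exact absurd hB (nU _).2.2
      | exact Or.inl hB
      | exact Or.inl hB.rotate
      | exact Or.inl hB.rotate.rotate
      | exact Or.inr hB
      | exact Or.inr hB.rotate
      | exact Or.inr hB.rotate.rotate
  · rintro (h | h)
    · exact ⟨S, by simp, T, by simp, U, by simp, h⟩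
    · exact ⟨S, by simp, U, by simp, T, by simp, h⟩

/-- A set of three pairwise disjoint loops. -/
def IsLoopLinking (L : Set (Set E3)) : Prop := ∃ S T U, LoopTriple S T U ∧ L = {S, T, U}

theorem ElementaryMove.invariants {L L' : Set (Set E3)} (hL : IsLoopLinking L)
    (h : ElementaryMove L L') : IsLoopLinking L' ∧ (SomeLinked L ↔ SomeLinked L') ∧
      (HasCenter L ↔ HasCenter L') ∧ (AllLinked L ↔ AllLinked L') ∧
      (IsBorromean L ↔ IsBorromean L') := by
  obtain ⟨A, B, C, C', -, hS, -, hav, rfl⟩ := h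
  -- The components are rotated to put the moved triangle first.
  obtain ⟨T, U, hl, rfl⟩ : ∃ T U, LoopTriple (outline A B C) T U ∧ L = {outline A B C, T, U} := by
    obtain ⟨X, Y, Z, hl, rfl⟩ := hL
    rcases hS with h | h | h
    · exact ⟨Y, Z, h ▸ hl, by rw [h]⟩
    · exact ⟨Z, X, h ▸ hl.rotate, by rw [h]; ext x; simp; tauto⟩
    · exact ⟨X, Y, h ▸ hl.rotate.rotate, by rw [← h]; ext x; simp; tauto⟩
  have n1 := hl.loop₁.ne_of_disjoint hl.disj₁₂
  have n2 := hl.loop₁.ne_of_disjoint hl.disj₁₃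
  have aT : MoveAvoids A B C C' T := hav T (by simp) n1.symm
  have aU : MoveAvoids A B C C' U := hav U (by simp) n2.symm
  have e : insert (outline A B C') ({outline A B C, T, U} \ {outline A B C}) =
      ({outline A B C', T, U} : Set (Set E3)) := by
    rw [Set.insert_sdiff_of_mem _ (Set.mem_singleton _), Set.sdiff_singleton_eq_self]
    simp [n1, n2]
  have hl' : LoopTriple (outline A B C') T U := by
    refine ⟨⟨_, _, _, rfl⟩, hl.loop₂, hl.loop₃, ?_, ?_, hl.disj₂₃⟩
    · simpa only [vertexPath_one] using aT.disjoint hl.disj₁₂ 1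
    · simpa only [vertexPath_one] using aU.disjoint hl.disj₁₃ 1
  have lT := aT.linked_iff hl.loop₂ hl.disj₁₂
  have lU := aU.linked_iff hl.loop₃ hl.disj₁₃
  rw [e, hl.someLinked_iff, hl'.someLinked_iff, hl.hasCenter_iff, hl'.hasCenter_iff,
    hl.allLinked_iff, hl'.allLinked_iff, hl.isBorromean_iff, hl'.isBorromean_iff, lT, lU,
    aT.borromeanTriple_iff aU hl.loop₂ hl.loop₃ hl.disj₁₂ hl.disj₁₃,
    aU.borromeanTriple_iff aT hl.loop₃ hl.loop₂ hl.disj₁₃ hl.disj₁₂]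
  exact ⟨⟨_, _, _, hl', rfl⟩, Iff.rfl, Iff.rfl, Iff.rfl, Iff.rfl⟩

theorem CombIsotopic.invariants {L L' : Set (Set E3)} (hL : IsLoopLinking L)
    (h : CombIsotopic L L') : IsLoopLinking L' ∧ (SomeLinked L ↔ SomeLinked L') ∧
      (HasCenter L ↔ HasCenter L') ∧ (AllLinked L ↔ AllLinked L') ∧
      (IsBorromean L ↔ IsBorromean L') := by
  induction h with
  | refl => exact ⟨hL, Iff.rfl, Iff.rfl, Iff.rfl, Iff.rfl⟩
  | tail _ hm ih =>
    obtain ⟨h0, h1, h2, h3, h4⟩ := ih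
    obtain ⟨k0, k1, k2, k3, k4⟩ := hm.invariants h0
    exact ⟨k0, h1.trans k1, h2.trans k2, h3.trans k3, h4.trans k4⟩

/-! ### A single transverse crossing gives linking -/

theorem outline_swap (A B C : E3) : outline B A C = outline A B C := by
  ext x
  simp only [outline, Set.mem_union, segment_symm ℝ B A, segment_symm ℝ A C, segment_symm ℝ C B]
  tauto

theorem normal_rotate (A B C : E3) : normal B C A = normal A B C := by
  ext i; fin_cases i <;> simp [normal] <;> ring

theorem normal_swap (A B C : E3) : normal B A C = -normal A B C := by
  ext i; fin_cases i <;> simp [normal] <;> ring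

theorem height_affineSpan {A B C x : E3} (hx : x ∈ affineSpan ℝ (outline A B C)) :
    height A B C x = 0 := by
  refine affineSpan_induction hx (fun y hy => height_hull (outline_subset_hull hy)) ?_
  · intro c u v w hu hv hw
    have : height A B C (c • (u -ᵥ v) +ᵥ w) =
        c * (height A B C u - height A B C v) + height A B C w := by
      simp [height, dot]; ring
    rw [this, hu, hv, hw]; ring

theorem mem_affineSpan_of_height {A B C x : E3} (hn : normal A B C ≠ 0)
    (hx : height A B C x = 0) : x ∈ affineSpan ℝ (outline A B C) := by
  have mA : A ∈ affineSpan ℝ (outline A B C) :=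
    subset_affineSpan ℝ _ (Or.inl (Or.inl (left_mem_segment _ _ _)))
  have mB : B ∈ affineSpan ℝ (outline A B C) :=
    subset_affineSpan ℝ _ (Or.inl (Or.inl (right_mem_segment _ _ _)))
  have mC : C ∈ affineSpan ℝ (outline A B C) :=
    subset_affineSpan ℝ _ (Or.inr (left_mem_segment _ _ _))
  have h := eq_bary hn hx
  have h1 := AffineSubspace.smul_vsub_vadd_mem _ (baryB A B C x) mB mA mA
  have h2 := AffineSubspace.smul_vsub_vadd_mem _ (baryC A B C x) mC mA h1
  convert h2 using 1
  rw [vsub_eq_sub, vsub_eq_sub, vadd_eq_add, vadd_eq_add]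
  nth_rewrite 1 [h]
  module

theorem height_mul_neg_of_sOppSide {A B C x y : E3} (hn : normal A B C ≠ 0)
    (h : (affineSpan ℝ (outline A B C)).SOppSide x y) :
    height A B C x * height A B C y < 0 := by
  obtain ⟨⟨p, hp, q, hq, hr⟩, hx, hy⟩ := h
  have hp0 := height_affineSpan hp
  have hq0 := height_affineSpan hq
  have hx0 : height A B C x ≠ 0 := fun h => hx (mem_affineSpan_of_height hn h)
  rcases hr with h | h | ⟨r, s, hr, hs, h⟩
  · rw [vsub_eq_zero_iff_eq] at h
    exact absurd (h ▸ hp) hx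
  · rw [vsub_eq_zero_iff_eq] at h
    exact absurd (h ▸ hq) hy
  · have e : r * (height A B C x - height A B C p) = s * (height A B C q - height A B C y) := by
      have h' := congrArg (dot (normal A B C)) h
      have k1 : dot (normal A B C) (r • (x -ᵥ p)) = r * (height A B C x - height A B C p) := by
        simp [height, dot]; ring
      have k2 : dot (normal A B C) (s • (q -ᵥ y)) = s * (height A B C q - height A B C y) := by
        simp [height, dot]; ring
      rw [← k1, ← k2, h']
    rw [hp0, hq0] at e
    have hxx : 0 < height A B C x * height A B C x := mul_self_pos.2 hx0
    have h1 : height A B C y = -(r / s) * height A B C x := by field_simp; linarith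
    rw [h1]
    have : 0 < r / s := by positivity
    nlinarith [mul_pos this hxx]

/-- The closed outline of `X Y Z` meets the plane of `A B C` at a second point `q`. If `outline A B
C` missed the hull of `X Y Z`, the segment from `p` to `q` would stay inside `A B C`, and `q` would
be a second crossing. -/
theorem meets_of_unique_crossing {A B C X Y Z p : E3} (hn : normal X Y Z ≠ 0)
    (hp : convexHull ℝ (outline A B C) ∩ outline X Y Z = {p})
    (hX : height A B C X < 0) (hY : 0 < height A B C Y) :
    (outline A B C ∩ convexHull ℝ (outline X Y Z)).Nonempty := by
  by_contra hcon
  have hp' : p ∈ convexHull ℝ (outline A B C) ∩ outline X Y Z := hp ▸ Set.mem_singleton p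
  -- a second point of the outline of `X Y Z` in the plane of `A B C`
  obtain ⟨q, hq, hq0, hqp⟩ : ∃ q ∈ outline X Y Z, height A B C q = 0 ∧ q ≠ p := by
    obtain ⟨a, b, c, ha, hb, hc, habc, h0, he⟩ := mem_outline.1 hp'.2
    have key : ∀ a' b' c' : ℝ, 0 ≤ a' → 0 ≤ b' → 0 ≤ c' → a' + b' + c' = 1 →
        (a' = 0 ∨ b' = 0 ∨ c' = 0) → c' ≠ c →
        a' * height A B C X + b' * height A B C Y + c' * height A B C Z = 0 →
        ∃ q ∈ outline X Y Z, height A B C q = 0 ∧ q ≠ p := by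
      intro a' b' c' h1 h2 h3 h4 h5 h6 h7
      refine ⟨a' • X + b' • Y + c' • Z, mem_outline.2 ⟨a', b', c', h1, h2, h3, h4, h5, rfl⟩,
        by rw [height_comb h4, h7], fun h => h6 ?_⟩
      have k1 := (bary_eq (A := X) (B := Y) (C := Z) hn habc).2
      have k2 := (bary_eq (A := X) (B := Y) (C := Z) hn h4).2
      rw [← k1, ← k2, h, he]
    set x := height A B C X
    set y := height A B C Y
    set z := height A B C Z
    -- The weight at `Z` tells `q` from `p`: if `p` lies on side `X Y`, the zero of the height is
    -- taken on the side joining `Z` to a vertex across the plane, with positive weight at `Z`;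
    -- otherwise on `X Y`.
    rcases hc.eq_or_lt with hc | hc
    · rcases le_or_gt 0 z with hz | hz
      · have hd : 0 < z - x := by linarith
        refine key (z / (z - x)) 0 (-x / (z - x)) (by positivity) le_rfl
          (div_nonneg (by linarith) hd.le) (by field_simp; ring) (by simp) ?_ (by field_simp; ring)
        rw [← hc]
        exact (div_pos (by linarith) hd).ne'
      · have hd : 0 < y - z := by linarith
        refine key 0 (-z / (y - z)) (y / (y - z)) le_rfl (div_nonneg (by linarith) hd.le)
          (by positivity) (by field_simp; ring) (by simp) ?_ (by field_simp; ring)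
        rw [← hc]
        positivity
    · have hd : 0 < y - x := by linarith
      exact key (y / (y - x)) (-x / (y - x)) 0 (by positivity) (div_nonneg (by linarith) hd.le)
        le_rfl (by field_simp; ring) (by simp) hc.ne (by field_simp; ring)
  have hqh := mem_hull_of_segment_disjoint hp'.1 hq0 fun x hx hx' => hcon ⟨x, hx',
    (convex_convexHull ℝ _).segment_subset (outline_subset_hull hp'.2) (outline_subset_hull hq) hx⟩
  have : q ∈ ({p} : Set E3) := hp ▸ ⟨hqh, hq⟩
  exact hqp this

theorem HopfLinked.linked {S T : Set E3} (hS : IsLoop S) (hT : IsTriangle T) (hd : Disjoint S T)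
    (h : HopfLinked S T) : Linked S T := by
  obtain ⟨A, B, C, rfl⟩ := hS
  obtain ⟨X, Y, Z, hi, rfl⟩ := hT
  have hn := normal_ne_zero_of_affineIndependent hi
  obtain ⟨⟨p, hp⟩, x, hx, y, hy, hxy⟩ := h
  have hp' : p ∈ convexHull ℝ (outline A B C) ∩ outline X Y Z := hp ▸ Set.mem_singleton p
  refine ⟨?_, ⟨p, hp'.2, hp'.1⟩⟩
  have hxy := height_mul_neg_of_sOppSide
    (normal_ne_zero_of_mem_hull hp'.1 (Set.disjoint_right.1 hd hp'.2)) hxy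
  obtain ⟨hneg, hpos⟩ : (∃ u ∈ outline X Y Z, height A B C u < 0) ∧
      ∃ u ∈ outline X Y Z, 0 < height A B C u := by
    rcases mul_neg_iff.1 hxy with h | h
    · exact ⟨⟨y, hy, h.2⟩, x, hx, h.1⟩
    · exact ⟨⟨x, hx, h.1⟩, y, hy, h.2⟩
  have vneg : height A B C X < 0 ∨ height A B C Y < 0 ∨ height A B C Z < 0 := by
    by_contra! hcon
    obtain ⟨u, hu, hu0⟩ := hneg
    obtain ⟨a, b, c, ha, hb, hc, habc, -, rfl⟩ := mem_outline.1 hu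
    rw [height_comb habc] at hu0
    nlinarith [mul_nonneg ha hcon.1, mul_nonneg hb hcon.2.1, mul_nonneg hc hcon.2.2]
  have vpos : 0 < height A B C X ∨ 0 < height A B C Y ∨ 0 < height A B C Z := by
    by_contra! hcon
    obtain ⟨u, hu, hu0⟩ := hpos
    obtain ⟨a, b, c, ha, hb, hc, habc, -, rfl⟩ := mem_outline.1 hu
    rw [height_comb habc] at hu0
    nlinarith [mul_nonneg ha (neg_nonneg.2 hcon.1), mul_nonneg hb (neg_nonneg.2 hcon.2.1),
      mul_nonneg hc (neg_nonneg.2 hcon.2.2)]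
  have r1 := outline_rotate X Y Z
  have r2 := (outline_rotate Y Z X).trans r1
  have n1 : normal Y Z X ≠ 0 := by rwa [normal_rotate]
  have n2 : normal Z X Y ≠ 0 := by rwa [normal_rotate]
  have sw : ∀ {U V W : E3}, normal U V W ≠ 0 → normal V U W ≠ 0 := fun h => by
    rwa [normal_swap, neg_ne_zero]
  have main : ∀ {U V W : E3}, normal U V W ≠ 0 → outline U V W = outline X Y Z →
      height A B C U < 0 → 0 < height A B C V →
      (outline A B C ∩ convexHull ℝ (outline X Y Z)).Nonempty := by
    intro U V W h1 h2 h3 h4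
    rw [← h2] at hp ⊢
    exact meets_of_unique_crossing h1 hp h3 h4
  rcases vneg with hu | hu | hu <;> rcases vpos with hv | hv | hv
  · linarith
  · exact main hn rfl hu hv
  · exact main (sw n2) ((outline_swap _ _ _).trans r2) hu hv
  · exact main (sw hn) (outline_swap _ _ _) hu hv
  · linarith
  · exact main n1 r1 hu hv
  · exact main n2 r2 hu hv
  · exact main (sw n1) ((outline_swap _ _ _).trans r1) hu hv
  · linarith

/-! ### Invariants of the separated, Hopf and open chain classes -/

theorem not_linked_of_disjoint {S T : Set E3} (h : Disjoint (convexHull ℝ T) S) : ¬ Linked S T :=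
  fun hl => hl.1.ne_empty (by rw [Set.inter_comm]; exact Set.disjoint_iff_inter_eq_empty.1 h)

theorem IsTripleLinking.loopTriple {S T U : Set E3} (h : IsTripleLinking {S, T, U}) :
    LoopTriple S T U := by
  obtain ⟨hc, ht, hd⟩ := h
  have two : ∀ X Y : Set E3, ({X, Y} : Set (Set E3)).ncard ≠ 3 := by
    intro X Y h
    have := Set.ncard_insert_le X {Y}
    rw [Set.ncard_singleton] at this
    omega
  have h1 : S ≠ T := by
    rintro rfl
    exact two S U (by simpa using hc)
  have h2 : S ≠ U := by
    rintro rfl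
    exact two T S (by rw [← hc]; congr 1; ext x; simp)
  have h3 : T ≠ U := by
    rintro rfl
    exact two S T (by simpa using hc)
  exact ⟨(ht S (by simp)).isLoop, (ht T (by simp)).isLoop, (ht U (by simp)).isLoop,
    hd (by simp) (by simp) h1, hd (by simp) (by simp) h2, hd (by simp) (by simp) h3⟩

theorem separated_invariants {L : Set (Set E3)} (h : L ∈ separated) :
    IsLoopLinking L ∧ ¬ SomeLinked L ∧ ¬ IsBorromean L := by
  obtain ⟨hL, S, T, U, rfl, h1, h2, h3⟩ := h
  have hl := hL.loopTriple
  refine ⟨⟨S, T, U, hl, rfl⟩, ?_, ?_⟩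
  · rw [hl.someLinked_iff]
    rintro (h | h | h)
    · exact not_linked_of_disjoint (h1.symm.mono_right outline_subset_hull) h
    · exact not_linked_of_disjoint (h2.symm.mono_right outline_subset_hull) h
    · exact not_linked_of_disjoint (h3.symm.mono_right outline_subset_hull) h
  · rw [hl.isBorromean_iff]
    rintro (⟨-, -, -, x, x1, x2, x3⟩ | ⟨-, -, -, x, x1, x2, x3⟩)
    · exact Set.disjoint_left.1 h1 x1 x2
    · exact Set.disjoint_left.1 h2 x1 x2

theorem hopfPlusOne_invariants {L : Set (Set E3)} (h : L ∈ hopfPlusOne) :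
    IsLoopLinking L ∧ SomeLinked L ∧ ¬ HasCenter L := by
  obtain ⟨hL, S, T, U, rfl, h1, h2, h3⟩ := h
  have hl := hL.loopTriple
  have k1 := h1.linked hl.loop₁ (hL.2.1 T (by simp)) hl.disj₁₂
  have k2 := not_linked_of_disjoint h2
  have k3 := not_linked_of_disjoint h3
  refine ⟨⟨S, T, U, hl, rfl⟩, ?_, ?_⟩
  · rw [hl.someLinked_iff]; exact Or.inl k1
  · rw [hl.hasCenter_iff]; tauto

theorem openChain_invariants {L : Set (Set E3)} (h : L ∈ openChain) :
    IsLoopLinking L ∧ SomeLinked L ∧ HasCenter L ∧ ¬ AllLinked L := by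
  obtain ⟨hL, S, T, U, rfl, h1, h2, h3⟩ := h
  have hl := hL.loopTriple
  have k1 := (h2.linked hl.loop₂ (hL.2.1 S (by simp)) hl.disj₁₂.symm).symm
  have k2 := (h3.linked hl.loop₃ (hL.2.1 S (by simp)) hl.disj₁₃.symm).symm
  have k3 := not_linked_of_disjoint (h1.symm.mono_right outline_subset_hull)
  rw [hl.someLinked_iff, hl.hasCenter_iff, hl.allLinked_iff]
  exact ⟨⟨S, T, U, hl, rfl⟩, by tauto, by tauto, by tauto⟩

/-! ### Invariants of the Borromean linking -/

theorem image_outline {f : E3 → E3}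
    (hf : ∀ (a b c : ℝ) (x y z : E3), a + b + c = 1 →
      f (a • x + b • y + c • z) = a • f x + b • f y + c • f z) (A B C : E3) :
    f '' outline A B C = outline (f A) (f B) (f C) := by
  ext x
  simp only [Set.mem_image, mem_outline]
  constructor
  · rintro ⟨_, ⟨a, b, c, ha, hb, hc, h, h0, rfl⟩, rfl⟩
    exact ⟨a, b, c, ha, hb, hc, h, h0, hf _ _ _ _ _ _ h⟩
  · rintro ⟨a, b, c, ha, hb, hc, h, h0, rfl⟩
    exact ⟨_, ⟨a, b, c, ha, hb, hc, h, h0, rfl⟩, hf _ _ _ _ _ _ h⟩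

theorem cyc_comb (a b c : ℝ) (x y z : E3) :
    cyc (a • x + b • y + c • z) = a • cyc x + b • cyc y + c • cyc z := by
  ext i; fin_cases i <;> simp [cyc]

theorem cyc_cyc_cyc (x : E3) : cyc (cyc (cyc x)) = x := by
  ext i; fin_cases i <;> simp [cyc]

theorem IsLoop.image_cyc {T : Set E3} (h : IsLoop T) : IsLoop (cyc '' T) := by
  obtain ⟨A, B, C, rfl⟩ := h
  exact ⟨_, _, _, image_outline (fun a b c x y z _ => cyc_comb a b c x y z) A B C⟩

theorem convexHull_image_cyc (T : Set E3) : convexHull ℝ (cyc '' T) = cyc '' convexHull ℝ T := by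
  have h : IsLinearMap ℝ cyc :=
    ⟨fun x y => by ext i; fin_cases i <;> simp [cyc],
      fun c x => by ext i; fin_cases i <;> simp [cyc]⟩
  exact (h.image_convexHull T).symm

theorem isLoop_borromeanTriangle : IsLoop borromeanTriangle := ⟨_, _, _, rfl⟩

/-- The image lies in the plane `x = 0` and meets `z = 0` only on the `y`-axis, at `1` and `-2/√5`.
The hull meets that axis only within distance `1/√10` of the origin, and `1/√10 < 2/√5 < 1`. -/
theorem image_cyc_borromeanTriangle_inter :
    cyc '' borromeanTriangle ∩ convexHull ℝ borromeanTriangle = ∅ := by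
  rw [Set.eq_empty_iff_forall_notMem]
  rintro _ ⟨⟨p, hp, rfl⟩, hx⟩
  obtain ⟨a, b, c, ha, hb, hc, h, h0, rfl⟩ := mem_outline.1 hp
  obtain ⟨a', b', c', ha', hb', hc', h', he⟩ := mem_hull.1 hx
  have e0 := congrArg (fun v : E3 => v 0) he
  have e1 := congrArg (fun v : E3 => v 1) he
  have e2 := congrArg (fun v : E3 => v 2) he
  simp [cyc] at e0 e1 e2
  have hq : (1 / √10 : ℝ) < 2 / √5 := by
    rw [div_lt_div_iff₀ (by positivity) (by positivity), one_mul]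
    have h1 : √5 < √10 := Real.sqrt_lt_sqrt (by norm_num) (by norm_num)
    have h2 : 0 < √10 := by positivity
    linarith
  have hq0 : (0 : ℝ) < 1 / √10 := by positivity
  have hr1 : (2 / √5 : ℝ) < 1 := by
    rw [div_lt_one (by positivity)]
    exact Real.lt_sqrt_of_sq_lt (by norm_num)
  rw [← one_div] at e1 e2
  generalize (1 / √10 : ℝ) = q at *
  generalize (2 / √5 : ℝ) = r at *
  obtain rfl : b = c := by
    have : (b - c) * q = 0 := by linarith
    rcases mul_eq_zero.1 this with h | h <;> linarith
  have k : (b' - c') * q < r ∧ -r < (b' - c') * q := by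
    constructor <;> nlinarith
  have hb0 : b = 0 ∨ a = 0 := by tauto
  rcases hb0 with rfl | rfl
  · obtain rfl : a = 1 := by linarith
    nlinarith
  · have : b = 1 / 2 := by linarith
    subst this
    nlinarith

theorem borromean_invariants {L : Set (Set E3)} (h : L ∈ borromean) :
    IsLoopLinking L ∧ ¬ SomeLinked L ∧ IsBorromean L := by
  obtain rfl := h
  set S := borromeanTriangle
  have l1 := isLoop_borromeanTriangle
  have l2 := l1.image_cyc
  have l3 := l2.image_cyc
  have hinj : Function.Injective cyc := Function.LeftInverse.injective (g := cyc ∘ cyc) cyc_cyc_cyc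
  have h1 : cyc '' S ∩ convexHull ℝ S = ∅ := image_cyc_borromeanTriangle_inter
  have h2 : cyc '' (cyc '' S) ∩ convexHull ℝ (cyc '' S) = ∅ := by
    rw [convexHull_image_cyc, ← Set.image_inter hinj, h1, Set.image_empty]
  have h3 : S ∩ convexHull ℝ (cyc '' (cyc '' S)) = ∅ := by
    have e : S = cyc '' (cyc '' (cyc '' S)) := by
      simp only [Set.image_image, cyc_cyc_cyc, Set.image_id']
    nth_rewrite 1 [e]
    rw [convexHull_image_cyc, ← Set.image_inter hinj, h2, Set.image_empty]
  -- Each image misses the hull of its predecessor, so the pattern runs against the order of the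
  -- permutation; the common point is the origin.
  have hB : BorromeanTriple S (cyc '' (cyc '' S)) (cyc '' S) := by
    have c0 : cyc 0 = 0 := by ext i; fin_cases i <;> simp [cyc]
    have hS : (0 : E3) ∈ convexHull ℝ S := by
      have hr : (0 : ℝ) < 2 / √5 := by positivity
      refine mem_hull.2 ⟨(2 / √5) / (1 + 2 / √5), (1 / 2) / (1 + 2 / √5), (1 / 2) / (1 + 2 / √5),
        by positivity, by positivity, by positivity, by field_simp; ring, ?_⟩
      generalize (2 / √5 : ℝ) = r at *
      ext i
      fin_cases i <;> simp; field_simp; ring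
    have hS1 : (0 : E3) ∈ convexHull ℝ (cyc '' S) := by
      rw [convexHull_image_cyc]; exact ⟨0, hS, c0⟩
    have hS2 : (0 : E3) ∈ convexHull ℝ (cyc '' (cyc '' S)) := by
      rw [convexHull_image_cyc]; exact ⟨0, hS1, c0⟩
    exact ⟨h3, h2, h1, 0, hS, hS2, hS1⟩
  have disj : ∀ {X Y : Set E3}, X ∩ convexHull ℝ Y = ∅ → Disjoint X Y := fun h =>
    (Set.disjoint_iff_inter_eq_empty.2 h).mono_right outline_subset_hull
  have hl : LoopTriple S (cyc '' S) (cyc '' (cyc '' S)) :=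
    ⟨l1, l2, l3, (disj h1).symm, disj h3, (disj h2).symm⟩
  refine ⟨⟨_, _, _, hl, rfl⟩, ?_, hl.isBorromean_iff.2 (Or.inr hB)⟩
  rw [hl.someLinked_iff]
  rintro (h | h | h)
  · exact h.2.ne_empty h1
  · exact h.1.ne_empty h3
  · exact h.2.ne_empty h2

/-! ### Invariants of the cyclic chain -/

/-- The isosceles triangle with apex `A`, altitude `w` and half of the base `e`. -/
def isosceles (A w e : E3) : Set E3 := outline A (A + w + e) (A + w - e)

/-- Linear independence of three vectors. -/
def Indep (w e f : E3) : Prop :=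
  ∀ α β γ : ℝ, α • w + β • e + γ • f = 0 → α = 0 ∧ β = 0 ∧ γ = 0

/-- By independence the two triangles can meet only on the common line of their altitudes. There the
outlines have the parameters `0`, `1` and `τ`, `1 + τ`, which are distinct and interleave. -/
theorem isosceles_linked_of_pos {A w e f : E3} {τ : ℝ} (hi : Indep w e f) (h0 : 0 < τ)
    (h1 : τ < 1) : Disjoint (isosceles A w e) (isosceles (A + τ • w) w f) ∧
      Linked (isosceles A w e) (isosceles (A + τ • w) w f) := by
  refine ⟨Set.disjoint_left.2 ?_, ⟨A + w, ?_, ?_⟩, A + τ • w, ?_, ?_⟩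
  · intro x hx hx'
    obtain ⟨a, b, c, ha, hb, hc, h, hz, rfl⟩ := mem_outline.1 hx
    obtain ⟨a', b', c', ha', hb', hc', h', hz', he⟩ := mem_outline.1 hx'
    obtain ⟨k1, k2, k3⟩ := hi (b + c - τ - b' - c') (b - c) (-(b' - c')) (by
      rw [← sub_eq_zero] at he
      rw [← he]
      obtain rfl : a = 1 - b - c := by linarith
      obtain rfl : a' = 1 - b' - c' := by linarith
      module)
    rcases hz with hz | hz | hz <;> rcases hz' with hz' | hz' | hz' <;> linarith
  · exact mem_outline.2 ⟨0, 1 / 2, 1 / 2, le_rfl, by norm_num, by norm_num, by norm_num, by simp,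
      by module⟩
  · exact mem_hull.2 ⟨τ, (1 - τ) / 2, (1 - τ) / 2, h0.le, by linarith, by linarith, by ring,
      by module⟩
  · exact mem_outline.2 ⟨1, 0, 0, zero_le_one, le_rfl, le_rfl, by norm_num, by simp, by module⟩
  · exact mem_hull.2 ⟨1 - τ, τ / 2, τ / 2, by linarith, by linarith, by linarith, by ring,
      by module⟩

theorem isosceles_linked {A w e f : E3} {τ : ℝ} (hi : Indep w e f) (h0 : τ ≠ 0)
    (h1 : |τ| < 1) : Disjoint (isosceles A w e) (isosceles (A + τ • w) w f) ∧
      Linked (isosceles A w e) (isosceles (A + τ • w) w f) := by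
  rw [abs_lt] at h1
  rcases h0.lt_or_gt with h | h
  · have hi' : Indep w f e := by
      intro α β γ hh
      have := hi α γ β (by rw [← hh]; abel)
      tauto
    -- A negative offset is a positive one seen from the second triangle.
    have := isosceles_linked_of_pos (A := A + τ • w) (τ := -τ) hi' (by linarith) (by linarith)
    have e : A + τ • w + -τ • w = A := by module
    rw [e] at this
    exact ⟨this.1.symm, this.2.symm⟩
  · exact isosceles_linked_of_pos hi h h1.2

theorem inner_eq_dot (x y : E3) : inner ℝ x y = dot x y := by
  simp [PiLp.inner_apply, Fin.sum_univ_three, dot]; ring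

theorem rotateAxis_eq (u : E3) (θ : ℝ) (x : E3) : rotateAxis u θ x =
    Real.cos θ • x + Real.sin θ • cross u x + ((1 - Real.cos θ) * dot u x) • u := by
  have : WithLp.toLp 2 (crossProduct u.ofLp x.ofLp) = cross u x := by
    ext i; fin_cases i <;> simp [cross, cross_apply]
  rw [rotateAxis, this, inner_eq_dot]

theorem rotateAxis_comb (u : E3) (θ a b : ℝ) (x y : E3) :
    rotateAxis u θ (a • x + b • y) = a • rotateAxis u θ x + b • rotateAxis u θ y := by
  simp only [rotateAxis_eq]
  ext i
  fin_cases i <;> simp [cross, dot] <;> ring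

theorem rotateAxis_smul_axis {u : E3} (hu : dot u u = 1) (θ a : ℝ) :
    rotateAxis u θ (a • u) = a • u := by
  have h1 : cross u (a • u) = 0 := by
    ext i; fin_cases i <;> simp [cross] <;> ring
  have h2 : dot u (a • u) = a * dot u u := by simp [dot]; ring
  rw [rotateAxis_eq, h1, h2, hu]
  module

theorem cross_cross {u e : E3} (hu : dot u u = 1) (he : dot u e = 0) :
    cross u (cross u e) = -e := by
  have : cross u (cross u e) = dot u e • u - dot u u • e := by
    ext i; fin_cases i <;> simp [cross, dot] <;> ring
  rw [this, hu, he]; module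

theorem rotateAxis_of_orthogonal {u e : E3} (hu : dot u u = 1) (he : dot u e = 0) (θ a b : ℝ) :
    rotateAxis u θ (a • e + b • cross u e) = (Real.cos θ * a - Real.sin θ * b) • e +
      (Real.sin θ * a + Real.cos θ * b) • cross u e := by
  have h2 : dot u (cross u e) = 0 := by simp [dot, cross]; ring
  have h1 := cross_cross hu he
  rw [rotateAxis_comb, rotateAxis_eq, rotateAxis_eq, he, h1, h2]
  module

/-- The frame `u`, `e`, `cross u e` is orthogonal, which reduces independence to a 2 by 2
determinant. -/
theorem indep_of_frame {u e : E3} {r a b a' b' : ℝ} (hu : dot u u = 1) (he : dot u e = 0)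
    (he0 : e ≠ 0) (hr : r ≠ 0) (hd : a * b' - b * a' ≠ 0) :
    Indep (r • u) (a • e + b • cross u e) (a' • e + b' • cross u e) := by
  intro α β γ h
  have hee := (dot_self_pos he0).ne'
  have e1 := congrArg (dot u) h
  have e2 := congrArg (dot e) h
  have e3 := congrArg (dot (cross u e)) h
  have z : ∀ x : E3, dot x 0 = 0 := fun x => by simp [dot]
  have lin : ∀ x : E3, dot x (α • r • u + β • (a • e + b • cross u e) +
      γ • (a' • e + b' • cross u e)) = α * r * dot x u + (β * a + γ * a') * dot x e +
      (β * b + γ * b') * dot x (cross u e) := fun x => by simp [dot]; ring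
  have d1 : dot u (cross u e) = 0 := by simp [dot, cross]; ring
  have d2 : dot e u = 0 := by rw [← he]; simp [dot]; ring
  have d3 : dot e (cross u e) = 0 := by simp [dot, cross]; ring
  have d4 : dot (cross u e) u = 0 := by simp [dot, cross]; ring
  have d5 : dot (cross u e) e = 0 := by simp [dot, cross]; ring
  have d6 : dot (cross u e) (cross u e) = dot e e := by
    have : dot (cross u e) (cross u e) = dot u u * dot e e - dot u e * dot u e := by
      simp [dot, cross]; ring
    rw [this, hu, he]; ring
  rw [lin, z, hu, he, d1] at e1
  rw [lin, z, d2, d3] at e2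
  rw [lin, z, d4, d5, d6] at e3
  have k1 : α = 0 := by simpa [hr] using e1
  have k2 : β * a + γ * a' = 0 := by simpa [hee] using e2
  have k3 : β * b + γ * b' = 0 := by simpa [hee] using e3
  refine ⟨k1, ?_, ?_⟩
  · have : β * (a * b' - b * a') = 0 := by linear_combination b' * k2 - a' * k3
    simpa [hd] using this
  · have : γ * (a * b' - b * a') = 0 := by linear_combination a * k3 - b * k2
    simpa [hd] using this

theorem screw_comb (p u : E3) (θ : ℝ) (h : E3) (a b c : ℝ) (x y z : E3) (habc : a + b + c = 1) :
    screw p u θ h (a • x + b • y + c • z) =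
      a • screw p u θ h x + b • screw p u θ h y + c • screw p u θ h z := by
  have e : a • x + b • y + c • z - p =
      (1 : ℝ) • (a • (x - p) + b • (y - p)) + c • (z - p) := by
    obtain rfl : a = 1 - b - c := by linarith
    module
  simp only [screw]
  rw [e, rotateAxis_comb, rotateAxis_comb]
  obtain rfl : a = 1 - b - c := by linarith
  module

/-- The screw motion along the altitude moves isosceles triangles to isosceles triangles. -/
theorem screw_image_isosceles {A u e : E3} (hu : dot u u = 1) (he : dot u e = 0)
    (θ r s t a b : ℝ) :
    screw A u θ (s • u) '' isosceles (A + t • u) (r • u) (a • e + b • cross u e) =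
      isosceles (A + (t + s) • u) (r • u) ((Real.cos θ * a - Real.sin θ * b) • e +
      (Real.sin θ * a + Real.cos θ * b) • cross u e) := by
  rw [isosceles, image_outline (fun a b c x y z h => screw_comb _ _ _ _ a b c x y z h), isosceles]
  have key : ∀ k l : ℝ, screw A u θ (s • u) (A + k • u + l • (a • e + b • cross u e)) =
      A + (k + s) • u + l • ((Real.cos θ * a - Real.sin θ * b) • e +
        (Real.sin θ * a + Real.cos θ * b) • cross u e) := by
    intro k l
    have e1 : A + k • u + l • (a • e + b • cross u e) - A =
        (1 : ℝ) • (k • u) + l • (a • e + b • cross u e) := by module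
    rw [screw, e1, rotateAxis_comb, rotateAxis_smul_axis hu, rotateAxis_of_orthogonal hu he]
    module
  congr 1
  · have := key t 0
    simpa using this
  · convert key (t + r) 1 using 2 <;> module
  · convert key (t + r) (-1) using 2 <;> module

/-- The altitude of an equilateral triangle is perpendicular to its base and bisects it. -/
theorem equilateral_altitude {A B C F : E3} (hAB : A ≠ B) (h1 : dist A B = dist B C)
    (h2 : dist B C = dist C A) (hF : F ∈ line[ℝ, B, C]) (hp : inner ℝ (F - A) (C - B) = 0) :
    F - A ≠ 0 ∧ B - F ≠ 0 ∧ inner ℝ (F - A) (B - F) = 0 ∧ C = F - (B - F) := by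
  obtain ⟨s, hs⟩ := vadd_left_mem_affineSpan_pair.1
    (show (F - B) +ᵥ B ∈ line[ℝ, B, C] by simpa using hF)
  obtain rfl : F = B + s • (C - B) := by rw [← vsub_eq_sub C, hs]; abel
  obtain ⟨b, rfl⟩ : ∃ b, B = A + b := ⟨B - A, by abel⟩
  obtain ⟨d, rfl⟩ : ∃ d, C = A + b + d := ⟨C - (A + b), by abel⟩
  have hb : b ≠ 0 := by rintro rfl; simp at hAB
  have n1 : ‖b‖ = ‖d‖ := by simpa [dist_eq_norm] using h1
  have n2 : ‖d‖ = ‖b + d‖ := by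
    have e : A + b + d - A = b + d := by abel
    rw [dist_comm] at h2
    simpa [dist_eq_norm, e] using h2
  have hb2 : 0 < inner ℝ b b := real_inner_self_pos.2 hb
  have m1 : inner ℝ b b = inner ℝ d d := by
    rw [real_inner_self_eq_norm_sq, real_inner_self_eq_norm_sq, n1]
  have m2 : inner ℝ d d = inner ℝ b b + 2 * inner ℝ b d + inner ℝ d d := by
    have h3 : inner ℝ d d = inner ℝ (b + d) (b + d) := by
      rw [real_inner_self_eq_norm_sq, real_inner_self_eq_norm_sq, n2]
    nth_rewrite 1 [h3]
    rw [real_inner_add_add_self]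
  have e1 : A + b + s • (A + b + d - (A + b)) - A = b + s • d := by module
  have e2 : A + b + d - (A + b) = d := by abel
  rw [e1, e2, inner_add_left, inner_smul_left] at hp
  simp only [conj_trivial] at hp
  -- Equal sides give `⟪b, d⟫ = -⟪b, b⟫ / 2`, so perpendicularity puts the foot at the midpoint.
  have hs : s = 1 / 2 := by
    have : (s - 1 / 2) * inner ℝ b b = 0 := by rw [← m1] at hp; linarith
    rcases mul_eq_zero.1 this with h | h <;> linarith
  subst hs
  have e3 : A + b - (A + b + (1 / 2 : ℝ) • d) = (-(1 / 2) : ℝ) • d := by module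
  rw [e1, e2, e3]
  have hd : d ≠ 0 := by rintro rfl; rw [inner_self_eq_zero.2 rfl] at m1; linarith
  refine ⟨fun h => ?_, by simpa using hd, ?_, by module⟩
  · have := congrArg (fun v => inner ℝ b v) h
    simp only [inner_add_right, inner_smul_right, inner_zero_right] at this
    linarith
  · rw [inner_add_left, inner_smul_left, inner_smul_right, inner_smul_right]
    simp only [conj_trivial]
    linarith

theorem cyclicChain_invariants {L : Set (Set E3)} (h : L ∈ cyclicChain) :
    IsLoopLinking L ∧ SomeLinked L ∧ HasCenter L ∧ AllLinked L := by
  obtain ⟨A, B, C, F, h, θ, hAB, h1, h2, hF, hp, hh, hθ, rfl⟩ := h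
  obtain ⟨hw, he, hwe, hC⟩ := equilateral_altitude hAB h1 h2 hF hp
  set u := ‖F - A‖⁻¹ • (F - A) with hu_def
  set e := B - F with he_def
  have hr : ‖F - A‖ ≠ 0 := norm_ne_zero_iff.2 hw
  set r := ‖F - A‖ with hr_def
  have hFA : F - A = r • u := by rw [hu_def, smul_smul, mul_inv_cancel₀ hr, one_smul]
  have hu : dot u u = 1 := by
    rw [← inner_eq_dot, hu_def, inner_smul_left, inner_smul_right, real_inner_self_eq_norm_sq,
      ← hr_def]
    simp only [conj_trivial]
    field_simp
  have hue : dot u e = 0 := by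
    rw [← inner_eq_dot, hu_def, inner_smul_left, hwe, mul_zero]
  obtain ⟨s, hs, rfl⟩ : ∃ s : ℝ, (s = 1 / 3 ∨ s = -(1 / 3)) ∧ h = (s * r) • u := by
    rcases hh with rfl | rfl
    · exact ⟨1 / 3, Or.inl rfl, by rw [hFA, smul_smul]⟩
    · refine ⟨-(1 / 3), Or.inr rfl, ?_⟩
      rw [← neg_sub, hFA]; module
  have hT : outline A B C = isosceles (A + (0 : ℝ) • u) (r • u)
      ((1 : ℝ) • e + (0 : ℝ) • cross u e) := by
    rw [isosceles, ← hFA, hC, he_def]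
    congr 1 <;> simp
  have hcos : Real.cos θ = 1 / 2 := by
    rcases hθ with rfl | rfl <;> simp
  have hsin : Real.sin θ ≠ 0 := by
    rcases hθ with rfl | rfl <;> simp
  have hcs := Real.sin_sq_add_cos_sq θ
  rw [hT, screw_image_isosceles hu hue, screw_image_isosceles hu hue]
  have pair : ∀ t t' a b a' b' τ : ℝ, t' = t + τ * r → τ ≠ 0 → |τ| < 1 → a * b' - b * a' ≠ 0 →
      Disjoint (isosceles (A + t • u) (r • u) (a • e + b • cross u e))
        (isosceles (A + t' • u) (r • u) (a' • e + b' • cross u e)) ∧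
      Linked (isosceles (A + t • u) (r • u) (a • e + b • cross u e))
        (isosceles (A + t' • u) (r • u) (a' • e + b' • cross u e)) := by
    intro t t' a b a' b' τ ht h0 h1 hd
    have := isosceles_linked (A := A + t • u) (τ := τ) (indep_of_frame hu hue he hr hd) h0 h1
    have e : A + t • u + τ • r • u = A + t' • u := by rw [ht]; module
    rwa [e] at this
  have hs0 : s ≠ 0 := by rcases hs with rfl | rfl <;> norm_num
  have hs1 : |s| < 1 := by rcases hs with rfl | rfl <;> norm_num [abs_lt]
  have hs2 : |2 * s| < 1 := by rcases hs with rfl | rfl <;> norm_num [abs_lt]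
  -- The offsets along the altitude are `s`, `2 * s`, `s` with `s = ±1/3`. The determinants of the
  -- half-bases are the sines of `θ`, `2θ`, `θ`, all equal to `sin θ` because `cos θ = 1/2`.
  obtain ⟨d12, l12⟩ := pair 0 (0 + s * r) 1 0 (Real.cos θ * 1 - Real.sin θ * 0)
    (Real.sin θ * 1 + Real.cos θ * 0) s rfl hs0 hs1 (by simpa using hsin)
  obtain ⟨d13, l13⟩ := pair 0 (0 + s * r + s * r) 1 0
    (Real.cos θ * (Real.cos θ * 1 - Real.sin θ * 0) - Real.sin θ *
      (Real.sin θ * 1 + Real.cos θ * 0))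
    (Real.sin θ * (Real.cos θ * 1 - Real.sin θ * 0) + Real.cos θ *
      (Real.sin θ * 1 + Real.cos θ * 0)) (2 * s) (by ring) (by simpa using hs0) hs2 (by
      rw [hcos]; intro h0; exact hsin (by linarith))
  obtain ⟨d23, l23⟩ := pair (0 + s * r) (0 + s * r + s * r) (Real.cos θ * 1 - Real.sin θ * 0)
    (Real.sin θ * 1 + Real.cos θ * 0)
    (Real.cos θ * (Real.cos θ * 1 - Real.sin θ * 0) - Real.sin θ *
      (Real.sin θ * 1 + Real.cos θ * 0))
    (Real.sin θ * (Real.cos θ * 1 - Real.sin θ * 0) + Real.cos θ *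
      (Real.sin θ * 1 + Real.cos θ * 0)) s rfl hs0 hs1 (by
      intro h0
      apply hsin
      have : Real.sin θ * (Real.sin θ ^ 2 + Real.cos θ ^ 2) = 0 := by rw [← h0]; ring
      rwa [hcs, mul_one] at this)
  have hl := LoopTriple.mk ⟨_, _, _, rfl⟩ ⟨_, _, _, rfl⟩ ⟨_, _, _, rfl⟩ d12 d13 d23
  refine ⟨⟨_, _, _, hl, rfl⟩, ?_, ?_, ?_⟩
  · exact hl.someLinked_iff.2 (Or.inl l12)
  · exact hl.hasCenter_iff.2 (Or.inl ⟨l12, l13⟩)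
  · exact hl.allLinked_iff.2 ⟨l12, l13, l23⟩

/-! ### Comparison of the five classes -/

theorem not_combIsotopic_of_ne {L L' : Set (Set E3)} (hL : IsLoopLinking L)
    (h : (SomeLinked L ∧ ¬ SomeLinked L') ∨ (¬ SomeLinked L ∧ SomeLinked L') ∨
      (HasCenter L ∧ ¬ HasCenter L') ∨ (¬ HasCenter L ∧ HasCenter L') ∨
      (AllLinked L ∧ ¬ AllLinked L') ∨ (¬ AllLinked L ∧ AllLinked L') ∨
      (IsBorromean L ∧ ¬ IsBorromean L') ∨ (¬ IsBorromean L ∧ IsBorromean L')) :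
    ¬ CombIsotopic L L' := by
  intro hc
  obtain ⟨-, h1, h2, h3, h4⟩ := hc.invariants hL
  tauto

end TriangleLinking

theorem proposition1p3 (i j : Fin 5) (hij : i ≠ j)
    (L L' : Set (Set TriangleLinking.E3))
    (hL : L ∈ TriangleLinking.listed i) (hL' : L' ∈ TriangleLinking.listed j) :
    ¬ TriangleLinking.CombIsotopic L L' := by
  open TriangleLinking in
  have h0 := @separated_invariants
  have h1 := @borromean_invariants
  have h2 := @hopfPlusOne_invariants
  have h3 := @openChain_invariants
  have h4 := @cyclicChain_invariants
  have main := @not_combIsotopic_of_ne L L'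
  fin_cases i <;> fin_cases j <;> first
    | exact absurd rfl hij
    | (simp only [listed] at hL hL'
       first
        | replace hL := h0 hL
        | replace hL := h1 hL
        | replace hL := h2 hL
        | replace hL := h3 hL
        | replace hL := h4 hL
       first
        | replace hL' := h0 hL'
        | replace hL' := h1 hL'
        | replace hL' := h2 hL'
        | replace hL' := h3 hL'
        | replace hL' := h4 hL'
       exact main hL.1 (by tauto))
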